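/- A simplicial complex is a finite family $\Sigma$ of finite sets (faces) that contains $\emptyset$ and is closed under taking subsets; $\dim F=|F|-1$, $\Sigma_i$ is the set of $i$-dimensional faces, $f_i(\Sigma)=|\Sigma_i|$, and $\Sigma_{(i)}$ is the set of faces of dimension $\le i$. Let $\tilde H_i$ denote reduced simplicial homology over $\mathbb Z$ and $\tilde\beta_i$ its rank. A complex of dimension $d$ is *acyclic in positive codimension* (APC) if $\tilde\beta_j=0$ for all $j<d$. A $d$-dimensional *simplicial spanning tree* of a $d$-dimensional complex $\Sigma$ is a $d$-dimensional subcomplex $\Upsilon\subseteq\Sigma$ with $\Upsilon_{(d-1)}=\Sigma_{(d-1)}$, $\tilde H_d(\Upsilon)=0$, $|\tilde H_{d-1}(\Upsilon)|<\infty$ and $f_d(\Upsilon)=f_d(\Sigma)-\tilde\beta_d(\Sigma)+\tilde\beta_{d-1}(\Sigma)$; let $\mathcal T_d(\Sigma)$ be the set of these. Let $x_1,x_2,\dots$ be indeterminates over a field of characteristic $0$, put $X_v=x_v^2$ and $E_t=X_1+\cdots+X_t$, and work in the field of rational functions in the $x_v$. The coarsely weighted tree enumerator is $$\hat\tau_d(\Sigma)=\sum_{\Upsilon\in\mathcal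 T_d(\Sigma)}|\tilde H_{d-1}(\Upsilon)|^2\prod_{F\in\Upsilon_d}\ \prod_{v\in F}X_v .$$ **Corollary 8.2.** Let $d\ge 0$, and let $\Sigma$ be a $d$-dimensional APC simplicial complex on the vertex set $[n]=\{1,\dots,n\}$ that is *shifted*: if $1\le i<j\le n$ and $F\in\Sigma$ with $i\notin F$, $j\in F$, then $(F\setminus\{j\})\cup\{i\}\in\Sigma$. (Every pure shifted complex is APC.) Let $\Delta=\{F\setminus\{1\}:F\in\Sigma\}$ and $\Lambda=\{F: 1\notin F,\ F\cup\{1\}\in\Sigma\}$ be the deletion and the link of the vertex $1$, and let $\tilde\Delta=1*\Delta$ and $\tilde\Lambda=1*\Lambda$, where $1*\Gamma=\{F,\,F\cup\{1\}:F\in\Gamma\}$. For a family $\mathcal F$ of subsets of $[n]$ let $\deg_{\mathcal F}(v)=|\{F\in\mathcal F:v\in F\}|$. Then $$\hat\tau_d(\Sigma)=\prod_{v=1}^n X_v^{\deg_{\tilde\Lambda_d}(v)}\ \cdot\ \prod_{i}\frac{E_{\lambda'_i}}{X_1},$$ where $\lambda=\bigl(\deg_{\tilde\Delta_{d+1}}(1),\dots,\deg_{\tilde\Delta_{d+1}}(n)\bigr)$,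 $\lambda'$ is the conjugate partition, $\lambda'_i=|\{v\in[n]:\lambda_v\ge i\}|$, and the last product runs over all (positive) parts of $\lambda'$, i.e. over $1\le i\le\max_v\lambda_v$. -/

import Mathlib

open scoped BigOperators

/-- A finite family `S` of finite sets of natural numbers is an (abstract) simplicial complex:
it contains the empty face and is closed under taking subsets.  The `i`-dimensional faces are the
members with `i + 1` elements; the empty face has dimension `-1`. -/
def IsComplex (S : Finset (Finset ℕ)) : Prop :=
  ∅ ∈ S ∧ ∀ F ∈ S, ∀ G, G ⊆ F → G ∈ S

/-- The set `S_i` of `i`-dimensional faces of `S`. -/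
def facesOfDim (S : Finset (Finset ℕ)) (i : ℤ) : Finset (Finset ℕ) :=
  S.filter fun F => (F.card : ℤ) = i + 1

/-- The `i`-skeleton `S_(i)`: all faces of dimension at most `i`. -/
def skeleton (S : Finset (Finset ℕ)) (i : ℤ) : Finset (Finset ℕ) :=
  S.filter fun F => (F.card : ℤ) ≤ i + 1

/-- `dim S = d`: the maximum of the dimensions of the faces is `d`. -/
def HasDim (S : Finset (Finset ℕ)) (d : ℤ) : Prop :=
  (∃ F ∈ S, (F.card : ℤ) = d + 1) ∧ ∀ F ∈ S, (F.card : ℤ) ≤ d + 1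

/-- `S` is shifted on the vertex set `[p, q]`: all faces are subsets of `[p, q]`, and whenever
`i < j` are in `[p, q]` and `F` is a face with `i ∉ F` and `j ∈ F`, then `(F \ {j}) ∪ {i}` is
a face. -/
def IsShiftedOn (p q : ℕ) (S : Finset (Finset ℕ)) : Prop :=
  (∀ F ∈ S, F ⊆ Finset.Icc p q) ∧
    ∀ F ∈ S, ∀ i ∈ Finset.Icc p q, ∀ j ∈ Finset.Icc p q,
      i < j → i ∉ F → j ∈ F → insert i (F.erase j) ∈ S

/-- The deletion `{F \ {p} : F ∈ S}`. -/
def deletion (p : ℕ) (S : Finset (Finset ℕ)) : Finset (Finset ℕ) :=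
  S.image fun F => F.erase p

/-- The link `{F : p ∉ F, F ∪ {p} ∈ S}` (every such `F` lies in the deletion of `p`, since
`F = (F ∪ {p}) \ {p}`). -/
def link (p : ℕ) (S : Finset (Finset ℕ)) : Finset (Finset ℕ) :=
  (deletion p S).filter fun F => p ∉ F ∧ insert p F ∈ S

/-- The cone `p * S = {F, F ∪ {p} : F ∈ S}`. -/
def cone (p : ℕ) (S : Finset (Finset ℕ)) : Finset (Finset ℕ) :=
  S ∪ S.image fun F => insert p F

/-! ### Reduced simplicial homology with integer coefficients -/

/-- The sign `ε(v, F)`: it is `(-1)^(j+1)` if `v` is the `j`-th smallest element of `F` (so that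
`j - 1` elements of `F` are smaller than `v`), and `0` if `v ∉ F`. -/
def faceSign (v : ℕ) (F : Finset ℕ) : ℤ :=
  if v ∈ F then (-1) ^ (F.filter fun u => u < v).card else 0

/-- The group `C_i(S)` of simplicial `i`-chains, as functions on the set of `i`-dimensional
faces. -/
abbrev Chains (S : Finset (Finset ℕ)) (i : ℤ) : Type :=
  {F // F ∈ facesOfDim S i} → ℤ

/-- The matrix of incidence numbers, with rows indexed by the `j`-dimensional faces and columns
indexed by the `i`-dimensional faces: the entry at `(G, F)` is `ε(v, F)` if `G = F \ {v}` for some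
`v ∈ F`, and `0` otherwise.  For `j = i - 1` this is the `i`-th boundary matrix; the two indices
are kept independent so that `∂ (i + 1) i` and `∂ i (i - 1)` can be composed. -/
def boundaryMatrix (S : Finset (Finset ℕ)) (i j : ℤ) :
    Matrix {G // G ∈ facesOfDim S j} {F // F ∈ facesOfDim S i} ℤ :=
  Matrix.of fun G F => ∑ v ∈ F.1, if F.1.erase v = G.1 then faceSign v F.1 else 0

/-- The boundary map `C_i(S) → C_j(S)`, to be used with `j = i - 1`. -/
noncomputable def boundary (S : Finset (Finset ℕ)) (i j : ℤ) : Chains S i →ₗ[ℤ] Chains S j :=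
  (boundaryMatrix S i j).mulVecLin

/-- The `i`-th reduced homology group `ker ∂_i / im ∂_{i+1}` over `ℤ`. -/
abbrev RedHomology (S : Finset (Finset ℕ)) (i : ℤ) : Type :=
  LinearMap.ker (boundary S i (i - 1)) ⧸
    (LinearMap.range (boundary S (i + 1) i)).submoduleOf (LinearMap.ker (boundary S i (i - 1)))

/-- The `i`-th reduced Betti number: the rank of the `i`-th reduced homology group. -/
noncomputable def redBetti (S : Finset (Finset ℕ)) (i : ℤ) : ℕ :=
  Module.finrank ℤ (RedHomology S i)

/-- A `d`-dimensional complex is acyclic in positive codimension (APC) if its reduced Betti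
numbers in all dimensions below `d` vanish. -/
def IsAPC (S : Finset (Finset ℕ)) (d : ℤ) : Prop :=
  ∀ j : ℤ, j < d → redBetti S j = 0

/-! ### Simplicial spanning trees and their weighted enumerator -/

/-- `T` is a `k`-dimensional simplicial spanning tree of `S`. -/
structure IsSpanningTree (S : Finset (Finset ℕ)) (k : ℤ) (T : Finset (Finset ℕ)) : Prop where
  isComplex : IsComplex T
  subset : T ⊆ S
  hasDim : HasDim T k
  skeleton_eq : skeleton T (k - 1) = skeleton S (k - 1)
  acyclic : Subsingleton (RedHomology T k)
  connected : Finite (RedHomology T (k - 1))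
  count : ((facesOfDim T k).card : ℤ) =
    ((facesOfDim S k).card : ℤ) - (redBetti S k : ℤ) + (redBetti S (k - 1) : ℤ)

open Classical in
/-- The finite set of all `k`-dimensional simplicial spanning trees of `S`. -/
noncomputable def spanningTrees (S : Finset (Finset ℕ)) (k : ℤ) :
    Finset (Finset (Finset ℕ)) :=
  S.powerset.filter fun T => IsSpanningTree S k T

/-- The weighted tree enumerator `∑_T |H_{k-1}(T)|² ∏_{F ∈ T_k} x_F²`, summed over all
`k`-dimensional simplicial spanning trees `T` of `S`, where `x` assigns a weight to each face. -/
noncomputable def treeEnumerator {R : Type*} [CommRing R] (S : Finset (Finset ℕ)) (k : ℤ)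
    (x : Finset ℕ → R) : R :=
  ∑ T ∈ spanningTrees S k,
    (Nat.card (RedHomology T (k - 1)) : R) ^ 2 * ∏ F ∈ facesOfDim T k, x F ^ 2

/-! ### The coarse weighting -/

/-- The indeterminate `x_v` in the field of rational functions over `𝕜`. -/
noncomputable def xVar (𝕜 : Type*) [Field 𝕜] (v : ℕ) : FractionRing (MvPolynomial ℕ 𝕜) :=
  algebraMap (MvPolynomial ℕ 𝕜) (FractionRing (MvPolynomial ℕ 𝕜)) (MvPolynomial.X v)

/-- `X_v = x_v²`. -/
noncomputable def XVar (𝕜 : Type*) [Field 𝕜] (v : ℕ) : FractionRing (MvPolynomial ℕ 𝕜) :=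
  xVar 𝕜 v ^ 2

/-- The linear form `E_t = X_1 + ⋯ + X_t`. -/
noncomputable def EForm (𝕜 : Type*) [Field 𝕜] (t : ℕ) : FractionRing (MvPolynomial ℕ 𝕜) :=
  ∑ i ∈ Finset.Icc 1 t, XVar 𝕜 i

/-- The coarse weight `x_F = ∏_{v ∈ F} x_v` of a face. -/
noncomputable def coarseWeight (𝕜 : Type*) [Field 𝕜] (F : Finset ℕ) :
    FractionRing (MvPolynomial ℕ 𝕜) :=
  ∏ v ∈ F, xVar 𝕜 v

/-! ### Degree sequences and conjugate partitions -/

/-- The degree of `v` in a family of sets: the number of members containing `v`. -/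
def familyDegree (𝓕 : Finset (Finset ℕ)) (v : ℕ) : ℕ :=
  (𝓕.filter fun F => v ∈ F).card

/-- The `i`-th part `#{v : l_v ≥ i}` (`i ≥ 1`) of the conjugate of the partition
`l = (l_1, …, l_n)`. -/
def conjPart (n : ℕ) (l : ℕ → ℕ) (i : ℕ) : ℕ :=
  ((Finset.Icc 1 n).filter fun v => i ≤ l v).card

/-- The number of (positive) parts of the conjugate of the partition `l = (l_1, …, l_n)`, which is
the largest part of `l`. -/
def conjLength (n : ℕ) (l : ℕ → ℕ) : ℕ :=
  (Finset.Icc 1 n).sup l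

/-!
Reduce the weighted Laplacian `∂ W ∂ᵀ` of the `d`-faces by deleting the rows and columns of the
`(d - 1)`-faces containing the vertex `1`. In a shifted complex the faces avoiding `1` describe the
homology in codimension one, so by Cauchy–Binet the determinant of what remains is the tree
enumerator.

As `β_{d-1} = 0`, every `(d - 1)`-face `G` avoiding `1` has `G ∪ {1}` in `Σ`. The `d`-faces are
therefore these cones, which contribute `X_1` times the identity after conjugation by the vertex
weights, and the `d`-faces of the deletion. This leaves the link monomial times
`det (1 + X_1⁻¹ ∂ ∂ᵀ)`, where `∂` is the boundary matrix of the `d`-faces of the deletion, with rows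
scaled by the vertex weights. Splitting again at the smallest vertex `p` gives a block matrix whose
determinant reduces to those of the deletion and the link of `p`; inductively it is
`∏_v (E_v / E_{v-1})^{deg v}`. Since the degrees are decreasing, the telescoping products along the
columns of their Young diagram are the factors `E_{λ'_i} / X_1`.
-/

section CauchyBinet

variable {n α R : Type*} [Fintype n] [DecidableEq n] [CommRing R]

theorem det_sum_mul_of_equiv {J : Finset α} (e : n ≃ J) (A : Matrix n α R) (B : Matrix α n R) :
    (Matrix.of fun i j => ∑ a ∈ J, A i a * B a j).det =
      (A.submatrix id fun i => (e i : α)).det * (B.submatrix (fun i => (e i : α)) id).det := by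
  rw [← Matrix.det_mul]
  congr 1
  ext i j
  simp only [Matrix.of_apply, Matrix.mul_apply, Matrix.submatrix_apply, id]
  rw [← Finset.sum_coe_sort, Equiv.sum_comp e fun a => A i a * B a j]

theorem det_sum_mul_eq_sum_injective [DecidableEq α] (s : Finset α) (A : Matrix n α R)
    (B : Matrix α n R) :
    (Matrix.of fun i j => ∑ a ∈ s, A i a * B a j).det =
      ∑ f ∈ Fintype.piFinset fun _ : n => s with Function.Injective f,
        (∏ i, A i (f i)) * (B.submatrix f id).det := by
  have hrows : (Matrix.of fun i j => ∑ a ∈ s, A i a * B a j) =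
      fun i => ∑ a ∈ s, A i a • B a := by
    ext i j
    simp [Finset.sum_apply]
  have hexpand : (Matrix.of fun i j => ∑ a ∈ s, A i a * B a j).det =
      ∑ f ∈ Fintype.piFinset fun _ : n => s, (∏ i, A i (f i)) * (B.submatrix f id).det := by
    rw [hrows]
    refine (Matrix.detRowAlternating.toMultilinearMap.map_sum_finset
      (fun i a => A i a • B a) (fun _ => s)).trans (Finset.sum_congr rfl fun f _ => ?_)
    exact Matrix.detRowAlternating.toMultilinearMap.map_smul_univ
      (fun i => A i (f i)) (fun i => B (f i))
  rw [hexpand, Finset.sum_filter_of_ne fun f _ hf => ?_]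
  contrapose! hf
  obtain ⟨i, j, hij, hne⟩ := Function.not_injective_iff.1 hf
  rw [Matrix.det_zero_of_row_eq hne (by ext k; simp [hij]), mul_zero]

/-- The **Cauchy–Binet formula**. The enumeration `e` of `J` is arbitrary, since both determinants
change by its sign. -/
theorem det_sum_mul_eq_sum_powersetCard (s : Finset α) (A : Matrix n α R) (B : Matrix α n R)
    (c : Finset α → R)
    (hc : ∀ J ∈ s.powersetCard (Fintype.card n), ∃ e : n ≃ J, c J =
      (A.submatrix id fun i => (e i : α)).det * (B.submatrix (fun i => (e i : α)) id).det) :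
    (Matrix.of fun i j => ∑ a ∈ s, A i a * B a j).det =
      ∑ J ∈ s.powersetCard (Fintype.card n), c J := by
  classical
  have himage : ∀ f ∈ (Fintype.piFinset fun _ : n => s).filter Function.Injective,
      Finset.univ.image f ∈ s.powersetCard (Fintype.card n) := by
    intro f hf
    rw [Finset.mem_filter, Fintype.mem_piFinset] at hf
    rw [Finset.mem_powersetCard, Finset.card_image_of_injective _ hf.2, Finset.card_univ]
    exact ⟨Finset.image_subset_iff.2 fun i _ => hf.1 i, rfl⟩
  rw [det_sum_mul_eq_sum_injective, ← Finset.sum_fiberwise_of_maps_to himage]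
  refine Finset.sum_congr rfl fun J hJ => ?_
  obtain ⟨e, he⟩ := hc J hJ
  rw [he, ← det_sum_mul_of_equiv e, det_sum_mul_eq_sum_injective, Finset.filter_filter]
  refine Finset.sum_congr (Finset.ext fun f => ?_) fun _ _ => rfl
  rw [Finset.mem_powersetCard] at hJ
  simp only [Finset.mem_filter, Fintype.mem_piFinset]
  constructor
  · rintro ⟨-, hinj, rfl⟩
    exact ⟨fun i => Finset.mem_image_of_mem f (Finset.mem_univ i), hinj⟩
  · rintro ⟨hf, hinj⟩
    refine ⟨fun i => hJ.1 (hf i), hinj, Finset.eq_of_subset_of_card_le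
      (Finset.image_subset_iff.2 fun i _ => hf i) ?_⟩
    rw [Finset.card_image_of_injective _ hinj, Finset.card_univ, hJ.2]

end CauchyBinet

/-! ### Weighted incidence numbers -/

/-- The entry at `(G, F)` of the simplicial boundary matrix in which removing the vertex `v` is
given the weight `x v`. -/
def weightedIncidence {R : Type*} [CommRing R] (x : ℕ → R) (G F : Finset ℕ) : R :=
  ∑ v ∈ F, if F.erase v = G then (faceSign v F : R) * x v else 0

section Incidence

theorem faceSign_erase_of_lt {v w : ℕ} {F : Finset ℕ} (hvw : v < w) (hv : v ∈ F) (hw : w ∈ F) :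
    faceSign w (F.erase v) = -faceSign w F := by
  have hcard : ((F.filter fun u => u < w).erase v).card + 1 = (F.filter fun u => u < w).card :=
    Finset.card_erase_add_one (Finset.mem_filter.2 ⟨hv, hvw⟩)
  rw [faceSign, faceSign, if_pos (Finset.mem_erase.2 ⟨hvw.ne', hw⟩), if_pos hw,
    Finset.filter_erase, ← hcard, pow_succ]
  ring

theorem faceSign_erase_of_gt {v w : ℕ} {F : Finset ℕ} (hvw : v < w) (hv : v ∈ F) :
    faceSign v (F.erase w) = faceSign v F := by
  rw [faceSign, faceSign, if_pos (Finset.mem_erase.2 ⟨hvw.ne, hv⟩), if_pos hv,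
    Finset.filter_erase, Finset.erase_eq_of_notMem]
  exact fun hw => hvw.not_gt (Finset.mem_filter.1 hw).2

theorem faceSign_mul_faceSign_erase {v w : ℕ} {F : Finset ℕ} (hv : v ∈ F) (hw : w ∈ F)
    (hvw : v ≠ w) :
    faceSign v F * faceSign w (F.erase v) = -(faceSign w F * faceSign v (F.erase w)) := by
  rcases hvw.lt_or_gt with h | h
  · rw [faceSign_erase_of_lt h hv hw, faceSign_erase_of_gt h hv]
    ring
  · rw [faceSign_erase_of_lt h hw hv, faceSign_erase_of_gt h hw]
    ring

theorem faceSign_insert_self {p : ℕ} {F : Finset ℕ} (hF : ∀ v ∈ F, p < v) :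
    faceSign p (insert p F) = 1 := by
  rw [faceSign, if_pos (Finset.mem_insert_self p F), Finset.filter_eq_empty_iff.2,
    Finset.card_empty, pow_zero]
  rw [Finset.forall_mem_insert]
  exact ⟨lt_irrefl p, fun v hv => (hF v hv).not_gt⟩

variable {R : Type*} [CommRing R] (x : ℕ → R)

theorem sum_weightedIncidence_mul {B : Finset (Finset ℕ)} {F : Finset ℕ}
    (hB : ∀ v ∈ F, F.erase v ∈ B) (h : Finset ℕ → R) :
    ∑ G ∈ B, weightedIncidence x G F * h G =
      ∑ v ∈ F, (faceSign v F : R) * x v * h (F.erase v) := by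
  simp only [weightedIncidence, Finset.sum_mul, ite_mul, zero_mul]
  rw [Finset.sum_comm]
  refine Finset.sum_congr rfl fun v hv => ?_
  rw [Finset.sum_ite_eq, if_pos (hB v hv)]

theorem sum_weightedIncidence_mul_weightedIncidence {B : Finset (Finset ℕ)} {F : Finset ℕ}
    (hB : ∀ v ∈ F, F.erase v ∈ B) (H : Finset ℕ) :
    ∑ G ∈ B, weightedIncidence x H G * weightedIncidence x G F = 0 := by
  simp only [mul_comm (weightedIncidence x H _)]
  rw [sum_weightedIncidence_mul x hB]
  simp only [weightedIncidence, Finset.mul_sum]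
  -- The two orders of removing a pair of vertices give opposite contributions.
  rw [Finset.sum_sigma']
  refine Finset.sum_involution (fun q _ => ⟨q.2, q.1⟩) ?_ ?_ ?_ fun _ _ => rfl
  · rintro ⟨v, w⟩ hq
    rw [Finset.mem_sigma, Finset.mem_erase] at hq
    obtain ⟨hv, hwv, hw⟩ := hq
    have hsign := congrArg (Int.cast : ℤ → R) (faceSign_mul_faceSign_erase hv hw hwv.symm)
    push_cast at hsign
    rw [Finset.erase_right_comm (a := w)]
    split_ifs
    · linear_combination x v * x w * hsign
    · ring
  · rintro ⟨v, w⟩ hq - h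
    exact Finset.ne_of_mem_erase (Finset.mem_sigma.1 hq).2 (congrArg Sigma.fst h)
  · rintro ⟨v, w⟩ hq
    rw [Finset.mem_sigma, Finset.mem_erase] at hq ⊢
    exact ⟨hq.2.2, hq.2.1.symm, hq.1⟩

theorem weightedIncidence_insert_right {p : ℕ} {G F : Finset ℕ} (hF : ∀ v ∈ F, p < v)
    (hG : p ∉ G) : weightedIncidence x G (insert p F) = if G = F then x p else 0 := by
  have hp : p ∉ F := fun h => lt_irrefl p (hF p h)
  rw [weightedIncidence, Finset.sum_insert hp, Finset.erase_insert hp, faceSign_insert_self hF,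
    Finset.sum_eq_zero, add_zero]
  · simp [eq_comm]
  · intro v hv
    refine if_neg fun h => hG ?_
    rw [← h, Finset.mem_erase]
    exact ⟨(hF v hv).ne, Finset.mem_insert_self _ _⟩

theorem weightedIncidence_insert_left {p : ℕ} {G F : Finset ℕ} (hF : p ∉ F) :
    weightedIncidence x (insert p G) F = 0 :=
  Finset.sum_eq_zero fun _ _ => if_neg fun h =>
    hF (Finset.mem_of_mem_erase (h ▸ Finset.mem_insert_self p G))

theorem weightedIncidence_insert_insert {p : ℕ} {G F : Finset ℕ} (hF : ∀ v ∈ F, p < v)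
    (hG : p ∉ G) :
    weightedIncidence x (insert p G) (insert p F) = -weightedIncidence x G F := by
  have hp : p ∉ F := fun h => lt_irrefl p (hF p h)
  rw [weightedIncidence, weightedIncidence, Finset.sum_insert hp, Finset.erase_insert hp,
    if_neg (fun h : F = insert p G => hp (h ▸ Finset.mem_insert_self p G)), zero_add,
    ← Finset.sum_neg_distrib]
  refine Finset.sum_congr rfl fun v hv => ?_
  have hsign : faceSign v (insert p F) = -faceSign v F := by
    have h := faceSign_erase_of_lt (hF v hv) (Finset.mem_insert_self p F)
      (Finset.mem_insert_of_mem hv)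
    rw [Finset.erase_insert hp] at h
    rw [h, neg_neg]
  have hiff : insert p (F.erase v) = insert p G ↔ F.erase v = G :=
    Finset.insert_erase_invOn.2.injOn.eq_iff (fun h => hp (Finset.mem_of_mem_erase h)) hG
  simp only [Finset.erase_insert_of_ne (hF v hv).ne, hiff, hsign]
  split_ifs
  · push_cast
    ring
  · rw [neg_zero]

end Incidence

/-! ### Boundary matrices of simplices -/

section Simplex

/-- The matrix of weighted incidence numbers of the simplex with vertex set `V`, indexed by all
faces regardless of dimension. -/
def simplexBoundary {R : Type*} [CommRing R] (x : ℕ → R) (V : Finset ℕ) :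
    Matrix V.powerset V.powerset R :=
  Matrix.of fun G F => weightedIncidence x G.1 F.1

/-- The diagonal projection onto the faces belonging to `K`. -/
def faceProjection (R : Type*) [CommRing R] (V : Finset ℕ) (K : Finset (Finset ℕ)) :
    Matrix V.powerset V.powerset R :=
  Matrix.diagonal fun G => if G.1 ∈ K then 1 else 0

/-- The faces of the simplex on `V ∪ {p}` split into the faces `G` of `V` (left summand) and the
faces `G ∪ {p}` (right summand). -/
def simplexSplit {p : ℕ} {V : Finset ℕ} (hp : p ∉ V) :
    V.powerset ⊕ V.powerset ≃ (insert p V).powerset where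
  toFun := Sum.elim
    (fun G => ⟨G.1, Finset.powerset_mono.2 (Finset.subset_insert p V) G.2⟩)
    (fun G => ⟨insert p G.1, Finset.mem_powerset.2
      (Finset.insert_subset_insert p (Finset.mem_powerset.1 G.2))⟩)
  invFun F :=
    have hF : F.1.erase p ∈ V.powerset :=
      Finset.mem_powerset.2 (Finset.subset_insert_iff.1 (Finset.mem_powerset.1 F.2))
    if p ∈ F.1 then Sum.inr ⟨F.1.erase p, hF⟩ else Sum.inl ⟨F.1.erase p, hF⟩
  left_inv := by
    rintro (⟨G, hG⟩ | ⟨G, hG⟩) <;>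
      have hpG : p ∉ G := fun h => hp (Finset.mem_powerset.1 hG h) <;>
      simp [hpG]
  right_inv := by
    rintro ⟨F, hF⟩
    by_cases hpF : p ∈ F <;> simp [hpF]

theorem simplexSplit_inl {p : ℕ} {V : Finset ℕ} (hp : p ∉ V) (G : V.powerset) :
    (simplexSplit hp (Sum.inl G)).1 = G.1 :=
  rfl

theorem simplexSplit_inr {p : ℕ} {V : Finset ℕ} (hp : p ∉ V) (G : V.powerset) :
    (simplexSplit hp (Sum.inr G)).1 = insert p G.1 :=
  rfl

variable {R : Type*} [CommRing R] (x : ℕ → R)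

theorem simplexBoundary_mul_self (V : Finset ℕ) :
    simplexBoundary x V * simplexBoundary x V = 0 := by
  ext ⟨H, hH⟩ ⟨F, hF⟩
  have hB : ∀ v ∈ F, F.erase v ∈ V.powerset := fun v _ =>
    Finset.mem_powerset.2 ((Finset.erase_subset v F).trans (Finset.mem_powerset.1 hF))
  rw [Matrix.mul_apply]
  exact (Finset.sum_coe_sort V.powerset
    fun G => weightedIncidence x H G * weightedIncidence x G F).trans
    (sum_weightedIncidence_mul_weightedIncidence x hB H)

theorem simplexBoundary_submatrix_simplexSplit {p : ℕ} {V : Finset ℕ} (hp : p ∉ V)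
    (hpV : ∀ v ∈ V, p < v) :
    (simplexBoundary x (insert p V)).submatrix (simplexSplit hp) (simplexSplit hp) =
      Matrix.fromBlocks (simplexBoundary x V) (x p • 1) 0 (-simplexBoundary x V) := by
  ext (⟨G, hG⟩ | ⟨G, hG⟩) (⟨F, hF⟩ | ⟨F, hF⟩) <;>
    have hG' : p ∉ G := fun h => hp (Finset.mem_powerset.1 hG h) <;>
    have hF' : ∀ v ∈ F, p < v := fun v hv => hpV v (Finset.mem_powerset.1 hF hv) <;>
    simp only [simplexBoundary, simplexSplit_inl, simplexSplit_inr, Matrix.submatrix_apply,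
      Matrix.fromBlocks_apply₁₁, Matrix.fromBlocks_apply₁₂, Matrix.fromBlocks_apply₂₁,
      Matrix.fromBlocks_apply₂₂, Matrix.of_apply, Matrix.zero_apply, Matrix.neg_apply,
      Matrix.smul_apply, Matrix.one_apply, Subtype.mk.injEq, smul_eq_mul, mul_ite, mul_one,
      mul_zero]
  · exact weightedIncidence_insert_right x hF' hG'
  · exact weightedIncidence_insert_left x fun h => hp (Finset.mem_powerset.1 hF h)
  · exact weightedIncidence_insert_insert x hF' hG'

theorem faceProjection_submatrix_simplexSplit {p : ℕ} {V : Finset ℕ} (hp : p ∉ V)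
    (K : Finset (Finset ℕ)) :
    (faceProjection R (insert p V) K).submatrix (simplexSplit hp) (simplexSplit hp) =
      Matrix.fromBlocks (faceProjection R V (K.nonMemberSubfamily p)) 0 0
        (faceProjection R V (K.memberSubfamily p)) := by
  rw [faceProjection, Matrix.submatrix_diagonal_equiv, faceProjection, faceProjection,
    Matrix.fromBlocks_diagonal]
  congr 1
  ext (⟨G, hG⟩ | ⟨G, hG⟩) <;>
    have hpG : p ∉ G := fun h => hp (Finset.mem_powerset.1 hG h)
  · exact if_congr (by simp [simplexSplit_inl, hpG]) rfl rfl
  · exact if_congr (by simp [simplexSplit_inr, hpG]) rfl rfl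

end Simplex

/-! ### Degrees in shifted families and near-cones -/

/-- `K` is a near-cone with apex `p`: any vertex of a member avoiding `p` may be replaced by `p`. -/
def IsNearCone (p : ℕ) (K : Finset (Finset ℕ)) : Prop :=
  ∀ F ∈ K, p ∉ F → ∀ v ∈ F, insert p (F.erase v) ∈ K

section Families

theorem familyDegree_eq_card_memberSubfamily (K : Finset (Finset ℕ)) (p : ℕ) :
    familyDegree K p = (K.memberSubfamily p).card :=
  (Finset.card_image_of_injOn ((Finset.erase_injOn' p).mono fun _ hF =>
    (Finset.mem_filter.1 hF).2)).symm

theorem familyDegree_eq_add_of_ne (K : Finset (Finset ℕ)) {p v : ℕ} (hv : v ≠ p) :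
    familyDegree K v =
      familyDegree (K.nonMemberSubfamily p) v + familyDegree (K.memberSubfamily p) v := by
  have hmem : (K.filter (v ∈ ·)).memberSubfamily p = (K.memberSubfamily p).filter (v ∈ ·) := by
    ext F
    simp only [Finset.mem_memberSubfamily, Finset.mem_filter, Finset.mem_insert, hv, false_or]
    tauto
  have hnonMem :
      (K.filter (v ∈ ·)).nonMemberSubfamily p = (K.nonMemberSubfamily p).filter (v ∈ ·) := by
    ext F
    simp only [Finset.mem_nonMemberSubfamily, Finset.mem_filter]
    tauto
  rw [familyDegree, ← Finset.card_memberSubfamily_add_card_nonMemberSubfamily p, hmem, hnonMem,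
    add_comm, familyDegree, familyDegree]

variable {p n : ℕ} {K : Finset (Finset ℕ)}

theorem IsShiftedOn.isNearCone (hK : IsShiftedOn p n K) : IsNearCone p K := by
  intro F hF hpF v hv
  have hvn := hK.1 F hF hv
  have hpv : p ≠ v := fun h => hpF (h ▸ hv)
  rw [Finset.mem_Icc] at hvn
  exact hK.2 F hF p (Finset.mem_Icc.2 ⟨le_rfl, hvn.1.trans hvn.2⟩) v (Finset.mem_Icc.2 hvn)
    (hvn.1.lt_of_ne hpv) hpF hv

theorem subset_Icc_succ {F : Finset ℕ} (hF : F ⊆ Finset.Icc p n) (hp : p ∉ F) :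
    F ⊆ Finset.Icc (p + 1) n := fun v hv => by
  have hvp : v ≠ p := fun h => hp (h ▸ hv)
  have := Finset.mem_Icc.1 (hF hv)
  exact Finset.mem_Icc.2 ⟨by lia, this.2⟩

theorem IsShiftedOn.nonMemberSubfamily (hK : IsShiftedOn p n K) :
    IsShiftedOn (p + 1) n (K.nonMemberSubfamily p) := by
  have hIcc : Finset.Icc (p + 1) n ⊆ Finset.Icc p n := Finset.Icc_subset_Icc_left p.le_succ
  simp only [IsShiftedOn, Finset.mem_nonMemberSubfamily]
  refine ⟨fun F hF => subset_Icc_succ (hK.1 F hF.1) hF.2, ?_⟩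
  intro F hF i hi j hj hij hiF hjF
  refine ⟨hK.2 F hF.1 i (hIcc hi) j (hIcc hj) hij hiF hjF, ?_⟩
  have hpi : p ≠ i := (Nat.lt_of_succ_le (Finset.mem_Icc.1 hi).1).ne
  simp [hpi, hF.2]

theorem IsShiftedOn.memberSubfamily (hK : IsShiftedOn p n K) :
    IsShiftedOn (p + 1) n (K.memberSubfamily p) := by
  have hIcc : Finset.Icc (p + 1) n ⊆ Finset.Icc p n := Finset.Icc_subset_Icc_left p.le_succ
  simp only [IsShiftedOn, Finset.mem_memberSubfamily]
  refine ⟨fun F hF => subset_Icc_succ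
    ((Finset.subset_insert p F).trans (hK.1 _ hF.1)) hF.2, ?_⟩
  intro F hF i hi j hj hij hiF hjF
  have hpi : p ≠ i := (Nat.lt_of_succ_le (Finset.mem_Icc.1 hi).1).ne
  have hpj : p ≠ j := (Nat.lt_of_succ_le (Finset.mem_Icc.1 hj).1).ne
  have h := hK.2 (insert p F) hF.1 i (hIcc hi) j (hIcc hj) hij (by simp [hpi.symm, hiF])
    (Finset.mem_insert_of_mem hjF)
  rw [Finset.erase_insert_of_ne hpj, Finset.insert_comm] at h
  exact ⟨h, by simp [hpi, hF.2]⟩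

end Families

/-! ### Determinants of weighted Gram matrices -/

section BlockRecursion

variable {ι R : Type*} [Fintype ι] [DecidableEq ι] [Field R] {D E P Q : Matrix ι ι R}
  {x y s t : R}

theorem one_add_smul_fromBlocks_mul_mul :
    1 + t⁻¹ • (Matrix.fromBlocks D (x • 1) 0 (-D) * Matrix.fromBlocks P 0 0 Q *
        Matrix.fromBlocks E 0 (y • 1) (-E)) =
      Matrix.fromBlocks (1 + t⁻¹ • (D * P * E + (x * y) • Q)) (-((x / t) • (Q * E)))
        (-((y / t) • (D * Q))) (1 + t⁻¹ • (D * Q * E)) := by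
  rw [Matrix.fromBlocks_multiply, Matrix.fromBlocks_multiply, Matrix.fromBlocks_smul,
    ← Matrix.fromBlocks_one, Matrix.fromBlocks_add]
  congr 1
  · simp [smul_smul, mul_comm]
  · simp [smul_smul, div_eq_inv_mul]
  · simp [smul_smul, div_eq_inv_mul]
  · simp

theorem fromBlocks_eliminate_lower_left (hs : s ≠ 0) (ht : t ≠ 0) (hst : s = t + x * y)
    (hQ : Q * Q = Q) (hDQDPE : D * Q * (D * P * E) = 0) :
    Matrix.fromBlocks 1 0 ((y / s) • (D * Q)) (1 : Matrix ι ι R) *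
        Matrix.fromBlocks (1 + t⁻¹ • (D * P * E + (x * y) • Q)) (-((x / t) • (Q * E)))
          (-((y / t) • (D * Q))) (1 + t⁻¹ • (D * Q * E)) =
      Matrix.fromBlocks (1 + t⁻¹ • (D * P * E + (x * y) • Q)) (-((x / t) • (Q * E))) 0
        (1 + s⁻¹ • (D * Q * E)) := by
  have hDQQ : D * Q * Q = D * Q := by rw [Matrix.mul_assoc, hQ]
  have hDQQE : D * Q * (Q * E) = D * Q * E := by rw [← Matrix.mul_assoc, hDQQ]
  have hlower : y / s + t⁻¹ * (x * y) * (y / s) - y / t = 0 := by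
    field_simp
    rw [hst]
    ring
  have hcorner : -(x / t * (y / s)) + t⁻¹ = s⁻¹ := by
    field_simp
    rw [hst]
    ring
  rw [Matrix.fromBlocks_multiply]
  congr 1
  · simp
  · simp
  · simp only [Matrix.smul_mul, Matrix.mul_add, Matrix.mul_one, Matrix.mul_smul, hDQDPE, hDQQ,
      Matrix.one_mul, smul_zero, zero_add, smul_add, smul_smul]
    rw [← add_smul, ← sub_eq_add_neg, ← sub_smul, hlower, zero_smul]
  · simp only [Matrix.smul_mul, Matrix.mul_smul, Matrix.mul_neg, hDQQE, Matrix.one_mul, smul_smul]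
    rw [add_left_comm, ← neg_smul, ← add_smul, hcorner]

theorem one_add_smul_add_eq_mul {A : Matrix ι ι R} {c : R} (hs : s ≠ 0) (ht : t ≠ 0)
    (hst : s = t + c) (hQA : Q * A = A) :
    1 + t⁻¹ • (A + c • Q) = (1 + (c / t) • Q) * (1 + s⁻¹ • A) := by
  have hinv : t⁻¹ = s⁻¹ + c / t * s⁻¹ := by
    field_simp
    rw [hst]
  simp only [Matrix.add_mul, Matrix.mul_add, Matrix.one_mul, Matrix.mul_one, Matrix.smul_mul,
    Matrix.mul_smul, hQA, smul_add, smul_smul]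
  rw [div_eq_inv_mul c t]
  nth_rewrite 1 [hinv]
  rw [div_eq_inv_mul c t, add_smul, mul_comm s⁻¹]
  abel

/-- The deletion–link recursion in block form. -/
theorem det_one_add_smul_fromBlocks (hs : s ≠ 0) (ht : t ≠ 0) (hst : s = t + x * y)
    (hD : D * D = 0) (hQ : Q * Q = Q) (hQDP : Q * (D * P) = D * P) :
    (1 + t⁻¹ • (Matrix.fromBlocks D (x • 1) 0 (-D) * Matrix.fromBlocks P 0 0 Q *
        Matrix.fromBlocks E 0 (y • 1) (-E))).det =
      (1 + (x * y / t) • Q).det * (1 + s⁻¹ • (D * P * E)).det *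
        (1 + s⁻¹ • (D * Q * E)).det := by
  have hQDPE : Q * (D * P * E) = D * P * E := by rw [← Matrix.mul_assoc, hQDP]
  have hDQDPE : D * Q * (D * P * E) = 0 := by
    rw [Matrix.mul_assoc, hQDPE, Matrix.mul_assoc D P, ← Matrix.mul_assoc, hD, Matrix.zero_mul]
  have helim := congrArg Matrix.det (fromBlocks_eliminate_lower_left hs ht hst hQ hDQDPE)
  rwa [Matrix.det_mul, Matrix.det_fromBlocks_zero₁₂, Matrix.det_fromBlocks_zero₂₁, Matrix.det_one,
    one_mul, one_mul, one_add_smul_add_eq_mul hs ht hst hQDPE, Matrix.det_mul,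
    ← one_add_smul_add_eq_mul hs ht hst hQDPE, ← one_add_smul_fromBlocks_mul_mul] at helim

end BlockRecursion

/-- The matrix `∂ ∂ᵀ` for the weighted incidence matrix `∂` with rows in `B` and columns in `K`. -/
def gramMatrix {R : Type*} [CommRing R] (x : ℕ → R) (B K : Finset (Finset ℕ)) : Matrix B B R :=
  Matrix.of fun G G' => ∑ F ∈ K, weightedIncidence x G.1 F * weightedIncidence x G'.1 F

section GramMatrix

variable {R : Type*} [CommRing R] (x : ℕ → R) {K B : Finset (Finset ℕ)} {V : Finset ℕ}

/-- Passing to `∂ᵀ ∂`, whose entries do not involve the row set `B`. -/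
theorem det_one_add_smul_gramMatrix_eq_columns (c : R) (hB : ∀ F ∈ K, ∀ v ∈ F, F.erase v ∈ B) :
    (1 + c • gramMatrix x B K).det =
      (1 + c • Matrix.of fun F F' : K => ∑ v ∈ F.1,
        (faceSign v F.1 : R) * x v * weightedIncidence x (F.1.erase v) F'.1).det := by
  let M : Matrix B K R := Matrix.of fun G F => weightedIncidence x G.1 F.1
  have hrows : gramMatrix x B K = M * M.transpose := by
    ext G G'
    exact (Finset.sum_coe_sort K
      fun F => weightedIncidence x G.1 F * weightedIncidence x G'.1 F).symm
  have hcols : (Matrix.of fun F F' : K => ∑ v ∈ F.1,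
      (faceSign v F.1 : R) * x v * weightedIncidence x (F.1.erase v) F'.1) = M.transpose * M := by
    ext F F'
    rw [Matrix.of_apply, ← sum_weightedIncidence_mul x (hB F.1 F.2)
      fun G => weightedIncidence x G F'.1, ← Finset.sum_coe_sort B]
    rfl
  rw [hrows, hcols, ← Matrix.smul_mul, Matrix.det_one_add_mul_comm, Matrix.mul_smul]

theorem simplexBoundary_mul_faceProjection_mul_transpose (hK : K ⊆ V.powerset) :
    simplexBoundary x V * faceProjection R V K * (simplexBoundary x V).transpose =
      gramMatrix x V.powerset K := by
  ext G G'
  rw [Matrix.mul_apply]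
  simp only [gramMatrix, faceProjection, Matrix.mul_diagonal, simplexBoundary, Matrix.of_apply,
    Matrix.transpose_apply, mul_ite, mul_one, mul_zero, ite_mul, zero_mul]
  rw [Finset.sum_coe_sort V.powerset fun F =>
    if F ∈ K then weightedIncidence x G.1 F * weightedIncidence x G'.1 F else 0,
    Finset.sum_ite_mem, Finset.inter_eq_right.2 hK]

theorem det_one_add_smul_faceProjection (c : R) (hK : K ⊆ V.powerset) :
    (1 + c • faceProjection R V K).det = (1 + c) ^ K.card := by
  have hentry : ∀ G : V.powerset, (1 : R) + c • (if G.1 ∈ K then 1 else 0) =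
      if G.1 ∈ K then 1 + c else 1 := fun G => by split_ifs <;> simp
  rw [faceProjection, ← Matrix.diagonal_one, ← Matrix.diagonal_smul, Matrix.diagonal_add,
    Matrix.det_diagonal]
  simp only [Pi.smul_apply, hentry]
  rw [Finset.prod_coe_sort V.powerset fun G => if G ∈ K then 1 + c else 1, Finset.prod_ite_mem,
    Finset.inter_eq_right.2 hK, Finset.prod_const]

/-- The near-cone property says that the facets of the deletion lie in the link. -/
theorem faceProjection_mul_simplexBoundary_mul {p : ℕ} (hp : p ∉ V) (hK : IsNearCone p K) :
    faceProjection R V (K.memberSubfamily p) *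
        (simplexBoundary x V * faceProjection R V (K.nonMemberSubfamily p)) =
      simplexBoundary x V * faceProjection R V (K.nonMemberSubfamily p) := by
  ext ⟨G, hG⟩ ⟨F, hF⟩
  simp only [faceProjection, Matrix.diagonal_mul, Matrix.mul_diagonal, simplexBoundary,
    Matrix.of_apply]
  by_cases hFK : F ∈ K.nonMemberSubfamily p
  swap
  · rw [if_neg hFK, mul_zero, mul_zero]
  by_cases hGK : G ∈ K.memberSubfamily p
  · rw [if_pos hGK, one_mul]
  rw [Finset.mem_nonMemberSubfamily] at hFK
  have hzero : weightedIncidence x G F = 0 := by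
    refine Finset.sum_eq_zero fun v hv => if_neg ?_
    rintro rfl
    exact hGK (Finset.mem_memberSubfamily.2 ⟨hK F hFK.1 hFK.2 v hv,
      fun h => hp (Finset.mem_powerset.1 hG h)⟩)
  rw [hzero, zero_mul, mul_zero]

end GramMatrix

section GramDeterminant

variable {R : Type*} [Field R] (x : ℕ → R) {K : Finset (Finset ℕ)}

theorem det_one_add_smul_gramMatrix_insert {p : ℕ} {V : Finset ℕ} (hpV : ∀ v ∈ V, p < v)
    (hKV : K ⊆ (insert p V).powerset) (hK : IsNearCone p K) {s t : R} (hs : s ≠ 0) (ht : t ≠ 0)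
    (hst : s = t + x p ^ 2) :
    (1 + t⁻¹ • gramMatrix x (insert p V).powerset K).det = (s / t) ^ familyDegree K p *
      (1 + s⁻¹ • gramMatrix x V.powerset (K.nonMemberSubfamily p)).det *
      (1 + s⁻¹ • gramMatrix x V.powerset (K.memberSubfamily p)).det := by
  have hp : p ∉ V := fun h => lt_irrefl p (hpV p h)
  have hdel : K.nonMemberSubfamily p ⊆ V.powerset := fun F hF => by
    rw [Finset.mem_nonMemberSubfamily] at hF
    exact Finset.mem_powerset.2 ((Finset.subset_insert_iff_of_notMem hF.2).1
      (Finset.mem_powerset.1 (hKV hF.1)))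
  have hlink : K.memberSubfamily p ⊆ V.powerset := fun F hF => by
    rw [Finset.mem_memberSubfamily] at hF
    exact Finset.mem_powerset.2 ((Finset.subset_insert_iff_of_notMem hF.2).1
      ((Finset.subset_insert p F).trans (Finset.mem_powerset.1 (hKV hF.1))))
  have hblocks := det_one_add_smul_fromBlocks (E := (simplexBoundary x V).transpose) hs ht
    (hst.trans (by rw [pow_two])) (simplexBoundary_mul_self x V)
    (by simp [faceProjection, Matrix.diagonal_mul_diagonal])
    (faceProjection_mul_simplexBoundary_mul x hp hK)
  have hratio : 1 + x p * x p / t = s / t := by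
    rw [hst]
    field_simp
  have htranspose : Matrix.fromBlocks (simplexBoundary x V).transpose 0 (x p • 1)
      (-(simplexBoundary x V).transpose) =
      (Matrix.fromBlocks (simplexBoundary x V) (x p • 1) 0 (-simplexBoundary x V)).transpose := by
    simp [Matrix.fromBlocks_transpose]
  rw [det_one_add_smul_faceProjection _ hlink, ← familyDegree_eq_card_memberSubfamily, hratio,
    simplexBoundary_mul_faceProjection_mul_transpose x hdel,
    simplexBoundary_mul_faceProjection_mul_transpose x hlink, htranspose,
    ← simplexBoundary_submatrix_simplexSplit x hp hpV, ← faceProjection_submatrix_simplexSplit hp,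
    Matrix.submatrix_mul_equiv, Matrix.transpose_submatrix, Matrix.submatrix_mul_equiv,
    simplexBoundary_mul_faceProjection_mul_transpose x hKV] at hblocks
  rw [← hblocks, ← Matrix.det_submatrix_equiv_self (simplexSplit hp), Matrix.submatrix_add,
    Matrix.submatrix_smul, Pi.add_apply, Pi.add_apply, Matrix.submatrix_one_equiv]
  rfl

theorem det_one_add_smul_gramMatrix_powerset {p n : ℕ} {g : ℕ → R} (hg : ∀ v, p ≤ v → g v ≠ 0)
    (hgx : ∀ v, p ≤ v → g (v + 1) = g v + x v ^ 2) (hK : IsShiftedOn p n K) :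
    (1 + (g p)⁻¹ • gramMatrix x (Finset.Icc p n).powerset K).det =
      ∏ v ∈ Finset.Icc p n, (g (v + 1) / g v) ^ familyDegree K v := by
  have hKpow : K ⊆ (Finset.Icc p n).powerset := fun F hF => Finset.mem_powerset.2 (hK.1 F hF)
  induction hm : n + 1 - p generalizing p K with
  | zero =>
    have hIcc : Finset.Icc p n = ∅ := Finset.Icc_eq_empty (by lia)
    have hgram : gramMatrix x (Finset.Icc p n).powerset K = 0 := by
      ext G G'
      refine Finset.sum_eq_zero fun F hF => ?_
      rw [hIcc, Finset.powerset_empty] at hKpow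
      simp [Finset.mem_singleton.1 (hKpow hF), weightedIncidence]
    rw [hgram, smul_zero, add_zero, Matrix.det_one, hIcc, Finset.prod_empty]
  | succ m ih =>
    have hIcc : Finset.Icc p n = insert p (Finset.Icc (p + 1) n) :=
      (Finset.insert_Icc_succ_left_eq_Icc (by lia)).symm
    have hg' : ∀ v, p + 1 ≤ v → g v ≠ 0 := fun v hv => hg v (by lia)
    have hgx' : ∀ v, p + 1 ≤ v → g (v + 1) = g v + x v ^ 2 := fun v hv => hgx v (by lia)
    have hdel := ih hg' hgx' hK.nonMemberSubfamily
      (fun F hF => Finset.mem_powerset.2 (hK.nonMemberSubfamily.1 F hF)) (by lia)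
    have hlink := ih hg' hgx' hK.memberSubfamily
      (fun F hF => Finset.mem_powerset.2 (hK.memberSubfamily.1 F hF)) (by lia)
    rw [hIcc] at hKpow ⊢
    rw [det_one_add_smul_gramMatrix_insert x (fun v hv => (Finset.mem_Icc.1 hv).1) hKpow
      hK.isNearCone (hg (p + 1) p.le_succ) (hg p le_rfl) (hgx p le_rfl), hdel, hlink,
      mul_assoc, ← Finset.prod_mul_distrib, Finset.prod_insert (by simp)]
    congr 1
    refine Finset.prod_congr rfl fun v hv => ?_
    have hvp : v ≠ p := (Nat.lt_of_succ_le (Finset.mem_Icc.1 hv).1).ne'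
    rw [← pow_add, ← familyDegree_eq_add_of_ne K hvp]

theorem IsShiftedOn.det_one_add_smul_gramMatrix {p n : ℕ} {B : Finset (Finset ℕ)} {g : ℕ → R}
    (hK : IsShiftedOn p n K) (hB : ∀ F ∈ K, ∀ v ∈ F, F.erase v ∈ B)
    (hg : ∀ v, p ≤ v → g v ≠ 0) (hgx : ∀ v, p ≤ v → g (v + 1) = g v + x v ^ 2) :
    (1 + (g p)⁻¹ • gramMatrix x B K).det =
      ∏ v ∈ Finset.Icc p n, (g (v + 1) / g v) ^ familyDegree K v := by
  rw [← det_one_add_smul_gramMatrix_powerset x hg hgx hK,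
    det_one_add_smul_gramMatrix_eq_columns x _ hB,
    det_one_add_smul_gramMatrix_eq_columns x _ fun F hF v _ =>
      Finset.mem_powerset.2 ((Finset.erase_subset v F).trans (hK.1 F hF))]

end GramDeterminant

/-! ### Homology of near-cones -/

section Homology

theorem mem_facesOfDim {S : Finset (Finset ℕ)} {i : ℤ} {F : Finset ℕ} :
    F ∈ facesOfDim S i ↔ F ∈ S ∧ (F.card : ℤ) = i + 1 :=
  Finset.mem_filter

/-- The `j`-dimensional faces of `T` avoiding the vertex `p`; they index the rows of the reduced
boundary matrix. -/
abbrev facesAvoiding (p : ℕ) (T : Finset (Finset ℕ)) (j : ℤ) : Finset (Finset ℕ) :=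
  (facesOfDim T j).nonMemberSubfamily p

variable {p : ℕ} {T : Finset (Finset ℕ)} {i j k : ℤ}

theorem lt_of_mem_facesAvoiding (hp : ∀ F ∈ T, ∀ v ∈ F, p ≤ v) {G : Finset ℕ}
    (hG : G ∈ facesAvoiding p T j) : ∀ v ∈ G, p < v := fun v hv => by
  rw [Finset.mem_nonMemberSubfamily, mem_facesOfDim] at hG
  exact (hp G hG.1.1 v hv).lt_of_ne fun h => hG.2 (h ▸ hv)

theorem weightedIncidence_insert_facesAvoiding (hp : ∀ F ∈ T, ∀ v ∈ F, p ≤ v)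
    (G G' : facesAvoiding p T j) :
    weightedIncidence (1 : ℕ → ℤ) G.1 (insert p G'.1) = if G = G' then 1 else 0 :=
  (weightedIncidence_insert_right _ (lt_of_mem_facesAvoiding hp G'.2)
    (Finset.mem_nonMemberSubfamily.1 G.2).2).trans (if_congr Subtype.ext_iff.symm rfl rfl)

theorem IsComplex.erase_mem_facesOfDim (hT : IsComplex T) (hij : i = j + 1) {F : Finset ℕ}
    (hF : F ∈ facesOfDim T i) {v : ℕ} (hv : v ∈ F) : F.erase v ∈ facesOfDim T j := by
  rw [mem_facesOfDim] at hF ⊢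
  have := Finset.card_erase_add_one hv
  exact ⟨hT.2 F hF.1 _ (Finset.erase_subset v F), by lia⟩

theorem IsNearCone.isNearCone_facesOfDim (hT : IsNearCone p T) (j : ℤ) :
    IsNearCone p (facesOfDim T j) := by
  intro F hF hpF v hv
  rw [mem_facesOfDim] at hF ⊢
  rw [Finset.card_insert_of_notMem fun h => hpF (Finset.mem_of_mem_erase h),
    Finset.card_erase_add_one hv]
  exact ⟨hT F hF.1 hpF v hv, hF.2⟩

theorem boundary_apply (c : Chains T i) (G : {G // G ∈ facesOfDim T j}) :
    boundary T i j c G = ∑ F, weightedIncidence (1 : ℕ → ℤ) G.1 F.1 * c F := by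
  simp [boundary, Matrix.mulVec, dotProduct, boundaryMatrix, weightedIncidence]

theorem sum_facesOfDim_incidence_mul_incidence {F : Finset ℕ}
    (hF : ∀ v ∈ F, F.erase v ∈ facesOfDim T j) (H : Finset ℕ) :
    ∑ G : {G // G ∈ facesOfDim T j},
      weightedIncidence (1 : ℕ → ℤ) H G.1 * weightedIncidence (1 : ℕ → ℤ) G.1 F = 0 :=
  (Finset.sum_coe_sort (facesOfDim T j)
    fun G => weightedIncidence (1 : ℕ → ℤ) H G * weightedIncidence (1 : ℕ → ℤ) G F).trans
    (sum_weightedIncidence_mul_weightedIncidence _ hF H)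

theorem boundary_boundary (hT : IsComplex T) (hij : i = j + 1) (c : Chains T i) :
    boundary T j k (boundary T i j c) = 0 := by
  ext H
  simp only [boundary_apply, Finset.mul_sum, Pi.zero_apply]
  rw [Finset.sum_comm]
  refine Finset.sum_eq_zero fun F _ => ?_
  simp only [← mul_assoc]
  rw [← Finset.sum_mul, sum_facesOfDim_incidence_mul_incidence
    (fun v hv => hT.erase_mem_facesOfDim hij F.2 hv), zero_mul]

/-- The restriction of chains to the faces avoiding `p`. -/
def restrictAvoiding (p : ℕ) (T : Finset (Finset ℕ)) (j : ℤ) :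
    Chains T j →ₗ[ℤ] (facesAvoiding p T j → ℤ) :=
  LinearMap.funLeft ℤ ℤ fun G => ⟨G.1, (Finset.mem_nonMemberSubfamily.1 G.2).1⟩

/-- A cycle supported on the faces containing `p` vanishes, because the coefficient of
`F \ {p}` in its boundary is its coefficient at `F`. -/
theorem eq_zero_of_restrictAvoiding_eq_zero (hT : IsComplex T) (hp : ∀ F ∈ T, ∀ v ∈ F, p ≤ v)
    (hjk : j = k + 1) {z : Chains T j} (hz : boundary T j k z = 0)
    (hres : restrictAvoiding p T j z = 0) : z = 0 := by
  have hzero : ∀ F : {F // F ∈ facesOfDim T j}, p ∉ F.1 → z F = 0 := fun F hF =>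
    congrFun hres ⟨F.1, Finset.mem_nonMemberSubfamily.2 ⟨F.2, hF⟩⟩
  ext F
  by_cases hpF : p ∈ F.1
  swap
  · exact hzero F hpF
  have hincidence : ∀ F' : {F // F ∈ facesOfDim T j}, p ∈ F'.1 →
      weightedIncidence (1 : ℕ → ℤ) (F.1.erase p) F'.1 = if F = F' then 1 else 0 := by
    intro F' hpF'
    have hlt : ∀ v ∈ F'.1.erase p, p < v := fun v hv =>
      (hp F'.1 (mem_facesOfDim.1 F'.2).1 v (Finset.mem_of_mem_erase hv)).lt_of_ne
        (Finset.ne_of_mem_erase hv).symm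
    have h := weightedIncidence_insert_right (1 : ℕ → ℤ) hlt (Finset.notMem_erase p F.1)
    rw [Finset.insert_erase hpF'] at h
    exact h.trans (if_congr
      (((Finset.erase_injOn' p).eq_iff hpF hpF').trans Subtype.ext_iff.symm) rfl rfl)
  have hcoeff := congrFun hz ⟨F.1.erase p, hT.erase_mem_facesOfDim hjk F.2 hpF⟩
  rw [boundary_apply, Finset.sum_eq_single F] at hcoeff
  · rwa [hincidence F hpF, if_pos rfl, one_mul] at hcoeff
  · intro F' _ hne
    by_cases hpF' : p ∈ F'.1
    · rw [hincidence F' hpF', if_neg hne.symm, zero_mul]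
    · rw [hzero F' hpF', mul_zero]
  · exact fun h => absurd (Finset.mem_univ F) h

/-- The combination with coefficients `y` of the boundaries of the simplices `insert p G`, which
need not themselves belong to `T`. -/
def coneCycle (y : facesAvoiding p T j → ℤ) : Chains T j :=
  fun F => ∑ G, weightedIncidence (1 : ℕ → ℤ) F.1 (insert p G.1) * y G

theorem restrictAvoiding_coneCycle (hp : ∀ F ∈ T, ∀ v ∈ F, p ≤ v)
    (y : facesAvoiding p T j → ℤ) : restrictAvoiding p T j (coneCycle y) = y := by
  ext G
  change ∑ G', weightedIncidence (1 : ℕ → ℤ) G.1 (insert p G'.1) * y G' = y G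
  simp only [weightedIncidence_insert_facesAvoiding hp, ite_mul, one_mul, zero_mul,
    Finset.sum_ite_eq, Finset.mem_univ, if_true]

theorem boundary_coneCycle (hcone : IsNearCone p (facesOfDim T j))
    (y : facesAvoiding p T j → ℤ) : boundary T j k (coneCycle y) = 0 := by
  have hfacets : ∀ G ∈ facesAvoiding p T j, ∀ v ∈ insert p G,
      (insert p G).erase v ∈ facesOfDim T j := by
    intro G hG v hv
    rw [Finset.mem_nonMemberSubfamily] at hG
    by_cases hvp : v = p
    · rw [hvp, Finset.erase_insert hG.2]
      exact hG.1
    · rw [Finset.erase_insert_of_ne (Ne.symm hvp)]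
      exact hcone G hG.1 hG.2 v (Finset.mem_of_mem_insert_of_ne hv hvp)
  ext H
  simp only [boundary_apply, coneCycle, Finset.mul_sum, Pi.zero_apply]
  rw [Finset.sum_comm]
  refine Finset.sum_eq_zero fun G _ => ?_
  simp only [← mul_assoc]
  rw [← Finset.sum_mul, sum_facesOfDim_incidence_mul_incidence (hfacets G.1 G.2), zero_mul]

/-- Cycles are determined by their coefficients at the faces avoiding `p`, which are arbitrary. -/
noncomputable def cycleEquiv (hT : IsComplex T) (hp : ∀ F ∈ T, ∀ v ∈ F, p ≤ v) (hjk : j = k + 1)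
    (hcone : IsNearCone p (facesOfDim T j)) :
    LinearMap.ker (boundary T j k) ≃ₗ[ℤ] (facesAvoiding p T j → ℤ) :=
  LinearEquiv.ofBijective ((restrictAvoiding p T j).comp (LinearMap.ker (boundary T j k)).subtype)
    ⟨(injective_iff_map_eq_zero _).2 fun z hz =>
      Subtype.ext (eq_zero_of_restrictAvoiding_eq_zero hT hp hjk z.2 hz),
    fun y => ⟨⟨coneCycle y, boundary_coneCycle hcone y⟩, restrictAvoiding_coneCycle hp y⟩⟩

/-- The rows of the boundary matrix `∂_{j+1}` indexed by the faces avoiding `p`. -/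
def reducedBoundary (p : ℕ) (T : Finset (Finset ℕ)) (j : ℤ) :
    Matrix (facesAvoiding p T j) {F // F ∈ facesOfDim T (j + 1)} ℤ :=
  Matrix.of fun G F => weightedIncidence (1 : ℕ → ℤ) G.1 F.1

theorem restrictAvoiding_boundary (c : Chains T (j + 1)) :
    restrictAvoiding p T j (boundary T (j + 1) j c) = (reducedBoundary p T j).mulVecLin c := by
  ext G
  exact boundary_apply c _

theorem ker_boundary_eq_ker_reducedBoundary (hT : IsComplex T) (hp : ∀ F ∈ T, ∀ v ∈ F, p ≤ v) :
    LinearMap.ker (boundary T (j + 1) j) = LinearMap.ker (reducedBoundary p T j).mulVecLin := by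
  ext c
  rw [LinearMap.mem_ker, LinearMap.mem_ker, ← restrictAvoiding_boundary]
  refine ⟨fun h => by rw [h, map_zero], fun h => ?_⟩
  exact eq_zero_of_restrictAvoiding_eq_zero hT hp (sub_add_cancel j 1).symm
    (boundary_boundary hT rfl c) h

/-- Codimension-one homology is the cokernel of the reduced boundary matrix. -/
noncomputable def homologyEquiv (hT : IsComplex T) (hp : ∀ F ∈ T, ∀ v ∈ F, p ≤ v)
    (hcone : IsNearCone p (facesOfDim T j)) :
    RedHomology T j ≃ₗ[ℤ]
      (facesAvoiding p T j → ℤ) ⧸ LinearMap.range (reducedBoundary p T j).mulVecLin :=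
  Submodule.Quotient.equiv _ _ (cycleEquiv hT hp (sub_add_cancel j 1).symm hcone) (by
    ext y
    constructor
    · rintro ⟨z, ⟨c, hc⟩, rfl⟩
      exact ⟨c, by rw [← restrictAvoiding_boundary, hc]; rfl⟩
    · rintro ⟨c, rfl⟩
      exact ⟨⟨boundary T (j + 1) j c, boundary_boundary hT rfl c⟩, ⟨c, rfl⟩,
        restrictAvoiding_boundary c⟩)

/-- Top-dimensional homology is the kernel of the reduced boundary matrix. -/
noncomputable def topHomologyEquiv (hT : IsComplex T) (hp : ∀ F ∈ T, ∀ v ∈ F, p ≤ v)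
    (htop : facesOfDim T (j + 1 + 1) = ∅) :
    RedHomology T (j + 1) ≃ₗ[ℤ] LinearMap.ker (reducedBoundary p T j).mulVecLin :=
  have hbot : LinearMap.range (boundary T (j + 1 + 1) (j + 1)) = ⊥ := by
    have : IsEmpty {F // F ∈ facesOfDim T (j + 1 + 1)} := ⟨fun F => by simpa [htop] using F.2⟩
    rw [LinearMap.range_eq_bot]
    ext c
    exact isEmptyElim c
  (Submodule.quotEquivOfEqBot _ (by
    rw [hbot]
    exact LinearMap.ker_eq_bot.2 (Submodule.injective_subtype _))).trans
    (LinearEquiv.ofEq _ _ (by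
      rw [add_sub_cancel_right, ker_boundary_eq_ker_reducedBoundary hT hp]))

theorem subsingleton_redHomology_iff (hT : IsComplex T) (hp : ∀ F ∈ T, ∀ v ∈ F, p ≤ v)
    (htop : facesOfDim T (j + 1 + 1) = ∅) :
    Subsingleton (RedHomology T (j + 1)) ↔
      LinearMap.ker (reducedBoundary p T j).mulVecLin = ⊥ :=
  (topHomologyEquiv hT hp htop).toEquiv.subsingleton_congr.trans
    Submodule.subsingleton_iff_eq_bot

theorem natCard_quotient_range_mulVecLin {m : Type*} [Fintype m] [DecidableEq m]
    {M : Matrix m m ℤ} (h : M.det ≠ 0) :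
    Nat.card ((m → ℤ) ⧸ LinearMap.range M.mulVecLin) = M.det.natAbs := by
  have hinj : Function.Injective M.mulVecLin := Matrix.mulVec_injective_of_det_ne_zero h
  rw [← Submodule.natAbs_det_equiv _ (LinearEquiv.ofInjective _ hinj), ← LinearMap.det_toLin' M]
  congr 2

theorem range_mulVecLin_submatrix {m n : Type*} [Fintype m] [Fintype n] (M : Matrix m n ℤ)
    (e : m ≃ n) :
    LinearMap.range (M.submatrix id e).mulVecLin = LinearMap.range M.mulVecLin := by
  rw [Matrix.mulVecLin_submatrix, LinearMap.range_comp, LinearMap.range_comp,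
    LinearMap.range_eq_top.2 (LinearMap.funLeft_surjective_of_injective ℤ ℤ _ e.symm.injective),
    Submodule.map_top]
  exact Submodule.map_id _

theorem natCard_redHomology (hT : IsComplex T) (hp : ∀ F ∈ T, ∀ v ∈ F, p ≤ v)
    (hcone : IsNearCone p (facesOfDim T j))
    (e : facesAvoiding p T j ≃ {F // F ∈ facesOfDim T (j + 1)})
    (h : ((reducedBoundary p T j).submatrix id e).det ≠ 0) :
    Nat.card (RedHomology T j) = ((reducedBoundary p T j).submatrix id e).det.natAbs := by
  rw [← natCard_quotient_range_mulVecLin h, range_mulVecLin_submatrix]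
  exact Nat.card_congr (homologyEquiv hT hp hcone).toEquiv

theorem reducedBoundary_mulVecLin_surjective (hp : ∀ F ∈ T, ∀ v ∈ F, p ≤ v)
    (hins : ∀ G ∈ facesAvoiding p T j, insert p G ∈ facesOfDim T (j + 1)) :
    Function.Surjective (reducedBoundary p T j).mulVecLin := by
  intro y
  refine ⟨∑ G, y G • Pi.single ⟨insert p G.1, hins G.1 G.2⟩ 1, ?_⟩
  ext G'
  have hincidence : ∀ G : facesAvoiding p T j,
      reducedBoundary p T j G' ⟨insert p G.1, hins G.1 G.2⟩ = if G' = G then 1 else 0 :=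
    weightedIncidence_insert_facesAvoiding hp G'
  simp only [map_sum, map_smul, Matrix.mulVecLin_apply, Matrix.mulVec_single_one, Finset.sum_apply,
    Pi.smul_apply, smul_eq_mul, Matrix.col_apply, hincidence, mul_ite, mul_one, mul_zero,
    Finset.sum_ite_eq, Finset.mem_univ, if_true]

theorem redBetti_add_card_facesAvoiding (hT : IsComplex T) (hp : ∀ F ∈ T, ∀ v ∈ F, p ≤ v)
    (htop : facesOfDim T (j + 1 + 1) = ∅)
    (hins : ∀ G ∈ facesAvoiding p T j, insert p G ∈ facesOfDim T (j + 1)) :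
    redBetti T (j + 1) + (facesAvoiding p T j).card = (facesOfDim T (j + 1)).card := by
  have hrank := Submodule.finrank_quotient_add_finrank
    (LinearMap.ker (reducedBoundary p T j).mulVecLin)
  rw [(LinearMap.quotKerEquivRange _).finrank_eq,
    LinearMap.range_eq_top.2 (reducedBoundary_mulVecLin_surjective hp hins), finrank_top,
    Module.finrank_fintype_fun_eq_card, Module.finrank_fintype_fun_eq_card, Fintype.card_coe,
    Fintype.card_coe, ← (topHomologyEquiv hT hp htop).finrank_eq] at hrank
  rw [redBetti, ← hrank, add_comm]

/-- If `G ∪ {p}` is not a face, no face of dimension `j + 1` contains `G`, so that the cokernel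
describing homology has a free summand generated by `G`. -/
theorem IsNearCone.insert_mem_of_redBetti_eq_zero (hcone : IsNearCone p T) (hT : IsComplex T)
    (hp : ∀ F ∈ T, ∀ v ∈ F, p ≤ v) (hβ : redBetti T j = 0) {G : Finset ℕ}
    (hG : G ∈ facesAvoiding p T j) : insert p G ∈ T := by
  by_contra hins
  have hpG : p ∉ G := (Finset.mem_nonMemberSubfamily.1 hG).2
  have hrow : ∀ F : {F // F ∈ facesOfDim T (j + 1)}, reducedBoundary p T j ⟨G, hG⟩ F = 0 := by
    refine fun F => Finset.sum_eq_zero fun v hv => if_neg ?_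
    have hFT := (mem_facesOfDim.1 F.2).1
    rintro rfl
    by_cases hpF : p ∈ F.1
    · have hpv : p = v := by_contra fun h => hpG (Finset.mem_erase.2 ⟨h, hpF⟩)
      exact hins (by rwa [hpv, Finset.insert_erase hv])
    · exact hins (hcone F.1 hFT hpF v hv)
  rw [redBetti, (homologyEquiv hT hp (hcone.isNearCone_facesOfDim j)).finrank_eq] at hβ
  obtain ⟨a, ha, htorsion⟩ :=
    Module.finrank_eq_zero_iff.1 hβ (Submodule.Quotient.mk (Pi.single ⟨G, hG⟩ 1))
  rw [← Submodule.Quotient.mk_smul, Submodule.Quotient.mk_eq_zero] at htorsion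
  obtain ⟨c, hc⟩ := htorsion
  have hcoeff := congrFun hc ⟨G, hG⟩
  simp only [Matrix.mulVecLin_apply, Matrix.mulVec, dotProduct, hrow, zero_mul,
    Finset.sum_const_zero, Pi.smul_apply, Pi.single_eq_same, smul_eq_mul, mul_one] at hcoeff
  exact ha hcoeff.symm

end Homology

/-! ### Degree products and conjugate partitions -/

section Degrees

theorem prod_pow_familyDegree {R : Type*} [CommMonoid R] {V : Finset ℕ} {K : Finset (Finset ℕ)}
    (hK : ∀ F ∈ K, F ⊆ V) (f : ℕ → R) :
    ∏ v ∈ V, f v ^ familyDegree K v = ∏ F ∈ K, ∏ v ∈ F, f v := by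
  have hprod : ∀ F ∈ K, ∏ v ∈ F, f v = ∏ v ∈ V, if v ∈ F then f v else 1 := fun F hF => by
    rw [Finset.prod_ite_mem, Finset.inter_eq_right.2 (hK F hF)]
  rw [Finset.prod_congr rfl hprod, Finset.prod_comm]
  refine Finset.prod_congr rfl fun v _ => ?_
  rw [← Finset.prod_filter, Finset.prod_const, familyDegree]

variable {p n : ℕ} {K : Finset (Finset ℕ)}

theorem familyDegree_image_insert {v : ℕ} (hK : ∀ F ∈ K, p ∉ F) (hv : v ≠ p) :
    familyDegree (K.image (insert p)) v = familyDegree K v := by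
  rw [familyDegree_eq_add_of_ne _ hv, Finset.memberSubfamily_image_insert hK,
    Finset.nonMemberSubfamily_image_insert]
  exact Nat.zero_add _

theorem IsShiftedOn.image_insert (hpn : p ≤ n) (hK : IsShiftedOn (p + 1) n K) :
    IsShiftedOn p n (K.image (insert p)) := by
  have hIcc : Finset.Icc (p + 1) n ⊆ Finset.Icc p n := Finset.Icc_subset_Icc_left p.le_succ
  simp only [IsShiftedOn, Finset.forall_mem_image]
  refine ⟨fun F hF => Finset.insert_subset (Finset.left_mem_Icc.2 hpn) ((hK.1 F hF).trans hIcc), ?_⟩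
  intro F hF i hi j hj hij hiF hjF
  rw [Finset.mem_insert, not_or] at hiF
  rw [Finset.mem_Icc] at hi hj
  have hjF : j ∈ F := Finset.mem_of_mem_insert_of_ne hjF (by lia)
  refine Finset.mem_image.2 ⟨insert i (F.erase j), ?_, ?_⟩
  · exact hK.2 F hF i (Finset.mem_Icc.2 (by lia)) j (Finset.mem_Icc.2 (by lia)) hij hiF.2 hjF
  · rw [Finset.erase_insert_of_ne (by lia), Finset.insert_comm]

theorem IsShiftedOn.antitoneOn_familyDegree (hK : IsShiftedOn p n K) :
    AntitoneOn (familyDegree K) (Finset.Icc p n) := by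
  intro v hv w hw hvw
  obtain rfl | hvw := hvw.eq_or_lt
  · rfl
  refine Finset.card_sdiff_le_card_sdiff_iff.1 (Finset.card_le_card_of_injOn
    (fun F => insert v (F.erase w)) ?_
    (Set.LeftInvOn.injOn (f₁' := fun F => insert w (F.erase v)) ?_))
  · intro F hF
    simp only [Finset.coe_sdiff, Finset.coe_filter, Set.mem_sdiff, Set.mem_ofPred_eq] at hF ⊢
    have hvF : v ∉ F := fun h => hF.2 ⟨hF.1.1, h⟩
    refine ⟨⟨hK.2 F hF.1.1 v hv w hw hvw hvF hF.1.2, Finset.mem_insert_self _ _⟩, ?_⟩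
    simp [hvw.ne']
  · intro F hF
    simp only [Finset.coe_sdiff, Finset.coe_filter, Set.mem_sdiff, Set.mem_ofPred_eq] at hF
    have hvF : v ∉ F.erase w := fun h => hF.2 ⟨hF.1.1, Finset.mem_of_mem_erase h⟩
    simp only [Finset.erase_insert hvF, Finset.insert_erase hF.1.2]

end Degrees

section ConjugatePartition

variable {n : ℕ} {l : ℕ → ℕ}

theorem filter_le_eq_Icc_conjPart (hl : AntitoneOn l (Finset.Icc 1 n)) (i : ℕ) :
    (Finset.Icc 1 n).filter (fun v => i ≤ l v) = Finset.Icc 1 (conjPart n l i) := by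
  have hlower : ∀ v ∈ (Finset.Icc 1 n).filter (fun v => i ≤ l v),
      Finset.Icc 1 v ⊆ (Finset.Icc 1 n).filter (fun v => i ≤ l v) := by
    intro v hv w hw
    rw [Finset.mem_filter] at hv ⊢
    rw [Finset.mem_Icc] at hw
    have hwn : w ∈ Finset.Icc 1 n :=
      Finset.mem_Icc.2 ⟨hw.1, hw.2.trans (Finset.mem_Icc.1 hv.1).2⟩
    exact ⟨hwn, hv.2.trans (hl hwn hv.1 hw.2)⟩
  refine Finset.eq_of_subset_of_card_le (fun v hv => ?_) (by rw [Nat.card_Icc]; rfl)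
  have hcard := Finset.card_le_card (hlower v hv)
  rw [Nat.card_Icc, Nat.add_sub_cancel] at hcard
  exact Finset.mem_Icc.2 ⟨(Finset.mem_Icc.1 (Finset.mem_filter.1 hv).1).1, hcard⟩

theorem conjPart_pos {i : ℕ} (hi : i ∈ Finset.Icc 1 (conjLength n l)) : 1 ≤ conjPart n l i := by
  rw [Finset.mem_Icc] at hi
  obtain ⟨v, hv, hiv⟩ := (Finset.le_sup_iff (show (⊥ : ℕ) < i from hi.1)).1 hi.2
  exact Finset.card_pos.2 ⟨v, Finset.mem_filter.2 ⟨hv, hiv⟩⟩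

theorem prod_Icc_prod_filter_le {R : Type*} [CommMonoid R] {s : Finset ℕ} {m : ℕ}
    (hm : ∀ v ∈ s, l v ≤ m) (f : ℕ → R) :
    ∏ i ∈ Finset.Icc 1 m, ∏ v ∈ s with i ≤ l v, f v = ∏ v ∈ s, f v ^ l v := by
  simp only [Finset.prod_filter]
  rw [Finset.prod_comm]
  refine Finset.prod_congr rfl fun v hv => ?_
  have hfilter : (Finset.Icc 1 m).filter (· ≤ l v) = Finset.Icc 1 (l v) := by
    ext i
    have := hm v hv
    simp only [Finset.mem_filter, Finset.mem_Icc]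
    lia
  rw [← Finset.prod_filter, hfilter, Finset.prod_const, Nat.card_Icc, Nat.add_sub_cancel]

variable {R : Type*} [Field R] {E : ℕ → R}

theorem prod_Icc_two_div (hE : ∀ t, 1 ≤ t → E t ≠ 0) {m : ℕ} (hm : 1 ≤ m) :
    ∏ v ∈ Finset.Icc 2 m, E v / E (v - 1) = E m / E 1 := by
  induction m, hm using Nat.le_induction with
  | base => simp [hE 1 le_rfl]
  | succ m hm ih =>
    rw [Finset.prod_Icc_succ_top (by lia), ih, mul_comm, Nat.add_sub_cancel,
      div_mul_div_cancel₀ (hE m hm)]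

theorem prod_conjPart_div (hE : ∀ t, 1 ≤ t → E t ≠ 0) (hl : AntitoneOn l (Finset.Icc 1 n)) :
    ∏ i ∈ Finset.Icc 1 (conjLength n l), E (conjPart n l i) / E 1 =
      ∏ v ∈ Finset.Icc 2 n, (E v / E (v - 1)) ^ l v := by
  have hsub : Finset.Icc 2 n ⊆ Finset.Icc 1 n := Finset.Icc_subset_Icc_left one_le_two
  rw [← prod_Icc_prod_filter_le fun v hv => Finset.le_sup (hsub hv)]
  refine Finset.prod_congr rfl fun i hi => ?_
  rw [← prod_Icc_two_div hE (conjPart_pos hi)]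
  refine Finset.prod_congr (Finset.ext fun v => ?_) fun _ _ => rfl
  have hfilter := Finset.ext_iff.1 (filter_le_eq_Icc_conjPart hl i) v
  simp only [Finset.mem_filter, Finset.mem_Icc] at hfilter ⊢
  lia

end ConjugatePartition

/-! ### Facets of the cones over the deletion and the link -/

section DeletionLink

variable {p : ℕ} {S : Finset (Finset ℕ)} {j : ℤ}

theorem HasDim.facesOfDim_add_one_eq_empty (hS : HasDim S j) : facesOfDim S (j + 1) = ∅ := by
  refine Finset.eq_empty_of_forall_notMem fun F hF => ?_
  rw [mem_facesOfDim] at hF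
  have := hS.2 F hF.1
  lia

theorem insert_mem_facesOfDim (hins : ∀ G ∈ facesAvoiding p S j, insert p G ∈ S) {G : Finset ℕ}
    (hG : G ∈ facesAvoiding p S j) : insert p G ∈ facesOfDim S (j + 1) := by
  have hG' := Finset.mem_nonMemberSubfamily.1 hG
  refine mem_facesOfDim.2 ⟨hins G hG, ?_⟩
  rw [Finset.card_insert_of_notMem hG'.2, Nat.cast_succ, (mem_facesOfDim.1 hG'.1).2]

theorem mem_link {F : Finset ℕ} : F ∈ link p S ↔ p ∉ F ∧ insert p F ∈ S := by
  rw [link, Finset.mem_filter, and_iff_right_iff_imp]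
  rintro ⟨hp, hF⟩
  exact Finset.mem_image.2 ⟨_, hF, Finset.erase_insert hp⟩

theorem IsComplex.mem_deletion (hS : IsComplex S) {F : Finset ℕ} :
    F ∈ deletion p S ↔ F ∈ S ∧ p ∉ F := by
  rw [deletion, Finset.mem_image]
  constructor
  · rintro ⟨G, hG, rfl⟩
    exact ⟨hS.2 G hG _ (Finset.erase_subset p G), Finset.notMem_erase p G⟩
  · rintro ⟨hF, hp⟩
    exact ⟨F, hF, Finset.erase_eq_of_notMem hp⟩

theorem facesOfDim_cone {L : Finset (Finset ℕ)} (hL : ∀ F ∈ L, p ∉ F)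
    (htop : facesOfDim L (j + 1) = ∅) :
    facesOfDim (cone p L) (j + 1) = (facesOfDim L j).image (insert p) := by
  have hbase : L.filter (fun F => (F.card : ℤ) = j + 1 + 1) = ∅ := htop
  rw [facesOfDim, cone, Finset.filter_union, hbase, Finset.empty_union, Finset.filter_image]
  congr 1
  refine Finset.filter_congr fun F hF => ?_
  rw [Finset.card_insert_of_notMem (hL F hF), Nat.cast_succ, add_left_inj]

theorem facesOfDim_cone_link (hS : IsComplex S) (htop : facesOfDim S (j + 1 + 1) = ∅)
    (hins : ∀ G ∈ facesAvoiding p S j, insert p G ∈ S) :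
    facesOfDim (cone p (link p S)) (j + 1) = (facesAvoiding p S j).image (insert p) := by
  have hlink : facesOfDim (link p S) j = facesAvoiding p S j := by
    ext F
    rw [mem_facesOfDim, mem_link, Finset.mem_nonMemberSubfamily, mem_facesOfDim]
    refine ⟨fun hF => ⟨⟨hS.2 _ hF.1.2 F (Finset.subset_insert p F), hF.2⟩, hF.1.1⟩, fun hF => ?_⟩
    exact ⟨⟨hF.2, hins F (Finset.mem_nonMemberSubfamily.2 ⟨mem_facesOfDim.2 hF.1, hF.2⟩)⟩, hF.1.2⟩
  rw [facesOfDim_cone (fun F hF => (mem_link.1 hF).1), hlink]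
  refine Finset.eq_empty_of_forall_notMem fun F hF => ?_
  rw [mem_facesOfDim, mem_link] at hF
  refine Finset.notMem_empty (insert p F) (htop ▸ mem_facesOfDim.2 ⟨hF.1.2, ?_⟩)
  rw [Finset.card_insert_of_notMem hF.1.1, Nat.cast_succ, hF.2]

theorem facesOfDim_cone_deletion (hS : IsComplex S) (htop : facesOfDim S (j + 1) = ∅) :
    facesOfDim (cone p (deletion p S)) (j + 1) = (facesAvoiding p S j).image (insert p) := by
  have hdel : ∀ i, facesOfDim (deletion p S) i = facesAvoiding p S i := fun i => by
    ext F
    rw [mem_facesOfDim, hS.mem_deletion, Finset.mem_nonMemberSubfamily, mem_facesOfDim,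
      and_right_comm]
  rw [facesOfDim_cone (fun F hF => (hS.mem_deletion.1 hF).2), hdel]
  rw [hdel, facesAvoiding, htop]
  rfl

end DeletionLink

/-! ### The reduced weighted Laplacian -/

section ReducedLaplacian

variable {R : Type*} [CommRing R] {p : ℕ} {S : Finset (Finset ℕ)} {j : ℤ}

/-- The weighted Laplacian `∂ W ∂ᵀ` of the `(j + 1)`-dimensional faces, `W` being the diagonal
matrix of the weights `w`, with only the rows and columns of the `j`-dimensional faces avoiding
`p`. -/
def reducedLaplacian (w : Finset ℕ → R) (p : ℕ) (S : Finset (Finset ℕ)) (j : ℤ) :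
    Matrix (facesAvoiding p S j) (facesAvoiding p S j) R :=
  Matrix.of fun G G' => ∑ F ∈ facesOfDim S (j + 1),
    weightedIncidence (1 : ℕ → R) G.1 F * (w F * weightedIncidence (1 : ℕ → R) G'.1 F)

theorem weightedIncidence_one_mul_prod (x : ℕ → R) (G F : Finset ℕ) :
    weightedIncidence (1 : ℕ → R) G F * ∏ v ∈ F, x v =
      (∏ v ∈ G, x v) * weightedIncidence x G F := by
  rw [weightedIncidence, weightedIncidence, Finset.sum_mul, Finset.mul_sum]
  refine Finset.sum_congr rfl fun v hv => ?_
  split_ifs with h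
  · rw [← h, ← Finset.mul_prod_erase F x hv, Pi.one_apply]
    ring
  · rw [zero_mul, mul_zero]

/-- Conjugating by vertex weights moves the face weights into the incidence numbers. -/
theorem reducedLaplacian_eq_mul_gramMatrix_mul (x : ℕ → R) :
    reducedLaplacian (fun F => (∏ v ∈ F, x v) ^ 2) p S j =
      Matrix.diagonal (fun G => ∏ v ∈ G.1, x v) *
        gramMatrix x (facesAvoiding p S j) (facesOfDim S (j + 1)) *
        Matrix.diagonal fun G => ∏ v ∈ G.1, x v := by
  ext G G'
  rw [Matrix.mul_diagonal, Matrix.diagonal_mul, reducedLaplacian, gramMatrix, Matrix.of_apply,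
    Matrix.of_apply, Finset.mul_sum, Finset.sum_mul]
  refine Finset.sum_congr rfl fun F _ => ?_
  linear_combination (weightedIncidence (1 : ℕ → R) G'.1 F * ∏ v ∈ F, x v) *
    weightedIncidence_one_mul_prod x G.1 F +
    (∏ v ∈ G.1, x v) * weightedIncidence x G.1 F * weightedIncidence_one_mul_prod x G'.1 F

theorem facesOfDim_add_one_eq_union (hS : IsComplex S)
    (hins : ∀ G ∈ facesAvoiding p S j, insert p G ∈ S) :
    facesOfDim S (j + 1) = (facesAvoiding p S j).image (insert p) ∪ facesAvoiding p S (j + 1) := by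
  ext F
  rw [Finset.mem_union, Finset.mem_image, Finset.mem_nonMemberSubfamily]
  constructor
  · intro hF
    by_cases hpF : p ∈ F
    · exact Or.inl ⟨F.erase p, Finset.mem_nonMemberSubfamily.2
        ⟨hS.erase_mem_facesOfDim rfl hF hpF, Finset.notMem_erase p F⟩, Finset.insert_erase hpF⟩
    · exact Or.inr ⟨hF, hpF⟩
  · rintro (⟨G, hG, rfl⟩ | hF)
    · exact insert_mem_facesOfDim hins hG
    · exact hF.1

theorem injOn_insert_facesAvoiding :
    Set.InjOn (insert p) (facesAvoiding p S j : Set (Finset ℕ)) :=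
  Set.LeftInvOn.injOn (f₁' := fun F => F.erase p) fun _ hG =>
    Finset.erase_insert (Finset.mem_nonMemberSubfamily.1 hG).2

theorem gramMatrix_image_insert_facesAvoiding (x : ℕ → R) (hp : ∀ F ∈ S, ∀ v ∈ F, p ≤ v) :
    gramMatrix x (facesAvoiding p S j) ((facesAvoiding p S j).image (insert p)) = x p ^ 2 • 1 := by
  have hincidence : ∀ (G : facesAvoiding p S j), ∀ H ∈ facesAvoiding p S j,
      weightedIncidence x G.1 (insert p H) = if G.1 = H then x p else 0 := fun G H hH =>
    weightedIncidence_insert_right x (lt_of_mem_facesAvoiding hp hH)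
      (Finset.mem_nonMemberSubfamily.1 G.2).2
  ext G G'
  rw [gramMatrix, Matrix.of_apply, Finset.sum_image injOn_insert_facesAvoiding]
  rw [Finset.sum_congr rfl fun H hH => by
      rw [hincidence G H hH, hincidence G' H hH, ite_mul, zero_mul],
    Finset.sum_ite_eq, if_pos G.2, Matrix.smul_apply, Matrix.one_apply, smul_eq_mul, mul_ite,
    mul_ite, mul_one, mul_zero, mul_zero, ← pow_two]
  exact if_congr (Subtype.ext_iff.symm.trans eq_comm) rfl rfl

theorem gramMatrix_facesOfDim_add_one (x : ℕ → R) (hS : IsComplex S)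
    (hp : ∀ F ∈ S, ∀ v ∈ F, p ≤ v) (hins : ∀ G ∈ facesAvoiding p S j, insert p G ∈ S) :
    gramMatrix x (facesAvoiding p S j) (facesOfDim S (j + 1)) =
      x p ^ 2 • 1 + gramMatrix x (facesAvoiding p S j) (facesAvoiding p S (j + 1)) := by
  have hdisj : Disjoint ((facesAvoiding p S j).image (insert p)) (facesAvoiding p S (j + 1)) := by
    rw [Finset.disjoint_left, Finset.forall_mem_image]
    exact fun G _ hG => (Finset.mem_nonMemberSubfamily.1 hG).2 (Finset.mem_insert_self p G)
  rw [← gramMatrix_image_insert_facesAvoiding x hp]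
  ext G G'
  rw [facesOfDim_add_one_eq_union hS hins]
  exact Finset.sum_union hdisj

theorem det_reducedLaplacian {K : Type*} [Field K] (x : ℕ → K) (hx : x p ≠ 0) (hS : IsComplex S)
    (hp : ∀ F ∈ S, ∀ v ∈ F, p ≤ v) (hins : ∀ G ∈ facesAvoiding p S j, insert p G ∈ S) :
    (reducedLaplacian (fun F => (∏ v ∈ F, x v) ^ 2) p S j).det =
      (∏ F ∈ (facesAvoiding p S j).image (insert p), ∏ v ∈ F, x v ^ 2) *
        (1 + (x p ^ 2)⁻¹ •
          gramMatrix x (facesAvoiding p S j) (facesAvoiding p S (j + 1))).det := by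
  have hprod : ∏ F ∈ (facesAvoiding p S j).image (insert p), ∏ v ∈ F, x v ^ 2 =
      (∏ G : facesAvoiding p S j, ∏ v ∈ G.1, x v) * (x p ^ 2) ^ (facesAvoiding p S j).card *
        ∏ G : facesAvoiding p S j, ∏ v ∈ G.1, x v := by
    rw [Finset.prod_image injOn_insert_facesAvoiding,
      Finset.prod_coe_sort (facesAvoiding p S j) fun G => ∏ v ∈ G, x v, ← Finset.prod_const,
      ← Finset.prod_mul_distrib, ← Finset.prod_mul_distrib]
    refine Finset.prod_congr rfl fun G hG => ?_
    rw [Finset.prod_insert (Finset.mem_nonMemberSubfamily.1 hG).2, Finset.prod_pow]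
    ring
  have hscale : gramMatrix x (facesAvoiding p S j) (facesOfDim S (j + 1)) = x p ^ 2 •
      (1 + (x p ^ 2)⁻¹ • gramMatrix x (facesAvoiding p S j) (facesAvoiding p S (j + 1))) := by
    rw [gramMatrix_facesOfDim_add_one x hS hp hins, smul_add, smul_inv_smul₀ (pow_ne_zero 2 hx)]
  rw [reducedLaplacian_eq_mul_gramMatrix_mul, hscale, Matrix.det_mul, Matrix.det_mul,
    Matrix.det_diagonal, Matrix.det_smul, Fintype.card_coe, hprod]
  ring

end ReducedLaplacian

/-! ### The weighted matrix–tree theorem -/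

section MatrixTree

theorem det_submatrix_ne_zero_iff {m n : Type*} [Fintype m] [DecidableEq m] [Fintype n]
    (M : Matrix m n ℤ) (e : m ≃ n) :
    (M.submatrix id e).det ≠ 0 ↔ LinearMap.ker M.mulVecLin = ⊥ := by
  have hker : (M.submatrix id e).det ≠ 0 ↔
      LinearMap.ker (M.submatrix id e).mulVecLin = ⊥ := by
    rw [Matrix.ker_mulVecLin_eq_bot_iff, Ne, ← Matrix.exists_mulVec_eq_zero_iff]
    push Not
    exact forall_congr' fun v => not_imp_not
  have hcomp : (M.submatrix id e).mulVecLin =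
      M.mulVecLin ∘ₗ (LinearEquiv.funCongrLeft ℤ ℤ e.symm).toLinearMap :=
    Matrix.mulVecLin_submatrix id e M
  rw [hker, hcomp, LinearMap.ker_eq_bot, LinearMap.ker_eq_bot, LinearMap.coe_comp]
  exact Function.Injective.of_comp_iff' _ (LinearEquiv.funCongrLeft ℤ ℤ e.symm).bijective

/-- The incidence numbers of a family `N` with an equinumerous family `J`, as a square matrix by
means of the enumeration `e`. -/
def incidenceMinor {N J : Finset (Finset ℕ)} (e : N ≃ J) : Matrix N N ℤ :=
  Matrix.of fun G G' => weightedIncidence (1 : ℕ → ℤ) G.1 (e G').1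

variable {R : Type*} [CommRing R] {p : ℕ} {j : ℤ} {S T N J : Finset (Finset ℕ)}

theorem subsingleton_redHomology_iff_det_ne_zero (hT : IsComplex T)
    (hp : ∀ F ∈ T, ∀ v ∈ F, p ≤ v) (htop : facesOfDim T (j + 1 + 1) = ∅)
    (hN : facesAvoiding p T j = N) (hJ : facesOfDim T (j + 1) = J) (e : N ≃ J) :
    Subsingleton (RedHomology T (j + 1)) ↔ (incidenceMinor e).det ≠ 0 := by
  subst hN hJ
  exact (subsingleton_redHomology_iff hT hp htop).trans (det_submatrix_ne_zero_iff _ e).symm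

theorem natCard_redHomology_eq_natAbs_det (hT : IsComplex T) (hp : ∀ F ∈ T, ∀ v ∈ F, p ≤ v)
    (hcone : IsNearCone p (facesOfDim T j)) (hN : facesAvoiding p T j = N)
    (hJ : facesOfDim T (j + 1) = J) (e : N ≃ J) (h : (incidenceMinor e).det ≠ 0) :
    Nat.card (RedHomology T j) = (incidenceMinor e).det.natAbs := by
  subst hN hJ
  exact natCard_redHomology hT hp hcone e h

theorem mem_skeleton {F : Finset ℕ} : F ∈ skeleton S j ↔ F ∈ S ∧ (F.card : ℤ) ≤ j + 1 :=
  Finset.mem_filter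

theorem isComplex_skeleton_union (hS : IsComplex S) (hj : -1 ≤ j)
    (hJ : J ⊆ facesOfDim S (j + 1)) : IsComplex (skeleton S j ∪ J) := by
  refine ⟨Finset.mem_union_left _ (mem_skeleton.2 ⟨hS.1, ?_⟩), fun F hF G hGF => ?_⟩
  · rw [Finset.card_empty, Nat.cast_zero]
    lia
  rcases eq_or_ne G F with rfl | hne
  · exact hF
  have hlt := Finset.card_lt_card (hGF.ssubset_of_ne hne)
  refine Finset.mem_union_left _ (mem_skeleton.2 ?_)
  rcases Finset.mem_union.1 hF with hF | hF
  · rw [mem_skeleton] at hF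
    exact ⟨hS.2 F hF.1 G hGF, by lia⟩
  · have hF := mem_facesOfDim.1 (hJ hF)
    exact ⟨hS.2 F hF.1 G hGF, by lia⟩

theorem skeleton_union_subset (hJ : J ⊆ facesOfDim S (j + 1)) : skeleton S j ∪ J ⊆ S :=
  Finset.union_subset (Finset.filter_subset _ _) (hJ.trans (Finset.filter_subset _ _))

theorem card_le_of_mem_skeleton_union (hJ : J ⊆ facesOfDim S (j + 1)) :
    ∀ F ∈ skeleton S j ∪ J, (F.card : ℤ) ≤ j + 1 + 1 := fun F hF => by
  rcases Finset.mem_union.1 hF with hF | hF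
  · have hcard := (mem_skeleton.1 hF).2
    lia
  · exact (mem_facesOfDim.1 (hJ hF)).2.le

theorem facesOfDim_add_one_skeleton_union (hJ : J ⊆ facesOfDim S (j + 1)) :
    facesOfDim (skeleton S j ∪ J) (j + 1) = J := by
  ext F
  rw [mem_facesOfDim, Finset.mem_union, mem_skeleton]
  refine ⟨?_, fun hF => ⟨Or.inr hF, (mem_facesOfDim.1 (hJ hF)).2⟩⟩
  rintro ⟨⟨-, hle⟩ | hF, hcard⟩
  · lia
  · exact hF

theorem skeleton_skeleton_union (hJ : J ⊆ facesOfDim S (j + 1)) :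
    skeleton (skeleton S j ∪ J) j = skeleton S j := by
  ext F
  rw [mem_skeleton, Finset.mem_union]
  refine ⟨?_, fun hF => ⟨Or.inl hF, (mem_skeleton.1 hF).2⟩⟩
  rintro ⟨hF | hF, hle⟩
  · exact hF
  · have hcard := (mem_facesOfDim.1 (hJ hF)).2
    lia

theorem facesOfDim_skeleton : facesOfDim (skeleton S j) j = facesOfDim S j := by
  rw [skeleton, facesOfDim, Finset.filter_filter]
  exact Finset.filter_congr fun F _ => and_iff_right_of_imp fun h => h.le

theorem facesOfDim_skeleton_union (hJ : J ⊆ facesOfDim S (j + 1)) :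
    facesOfDim (skeleton S j ∪ J) j = facesOfDim S j := by
  rw [← facesOfDim_skeleton, skeleton_skeleton_union hJ, facesOfDim_skeleton]

theorem facesAvoiding_skeleton_union (hJ : J ⊆ facesOfDim S (j + 1)) :
    facesAvoiding p (skeleton S j ∪ J) j = facesAvoiding p S j := by
  rw [facesAvoiding, facesOfDim_skeleton_union hJ]

theorem facesOfDim_add_two_skeleton_union (hJ : J ⊆ facesOfDim S (j + 1)) :
    facesOfDim (skeleton S j ∪ J) (j + 1 + 1) = ∅ :=
  Finset.filter_false_of_mem fun F hF => by
    have hle := card_le_of_mem_skeleton_union hJ F hF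
    lia

theorem IsSpanningTree.skeleton_union_facesOfDim (hT : IsSpanningTree S (j + 1) T) :
    skeleton S j ∪ facesOfDim T (j + 1) = T := by
  have hskel := hT.skeleton_eq
  rw [add_sub_cancel_right] at hskel
  rw [← hskel]
  ext F
  rw [Finset.mem_union, mem_skeleton, mem_facesOfDim, ← and_or_left, and_iff_left_iff_imp]
  intro hF
  have hle := hT.hasDim.2 F hF
  lia

open Classical in
theorem treeEnumerator_eq_sum_powersetCard (w : Finset ℕ → R) {m : ℕ}
    (hm : (m : ℤ) = (facesOfDim S (j + 1)).card - redBetti S (j + 1) + redBetti S j) :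
    treeEnumerator S (j + 1) w = ∑ J ∈ (facesOfDim S (j + 1)).powersetCard m,
      if IsSpanningTree S (j + 1) (skeleton S j ∪ J) then
        (Nat.card (RedHomology (skeleton S j ∪ J) j) : R) ^ 2 * ∏ F ∈ J, w F ^ 2
      else 0 := by
  rw [← Finset.sum_filter, treeEnumerator, spanningTrees, add_sub_cancel_right]
  have hleft : ∀ T ∈ S.powerset.filter fun T => IsSpanningTree S (j + 1) T,
      skeleton S j ∪ facesOfDim T (j + 1) = T := fun T hT =>
    (Finset.mem_filter.1 hT).2.skeleton_union_facesOfDim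
  refine Finset.sum_bij' (fun T _ => facesOfDim T (j + 1)) (fun J _ => skeleton S j ∪ J)
    (fun T hT => ?_) (fun J hJ => ?_) hleft (fun J hJ => ?_) fun T hT => by rw [hleft T hT]
  · have hleftT := hleft T hT
    have hT := (Finset.mem_filter.1 hT).2
    have hcount := hT.count
    rw [add_sub_cancel_right, ← hm, Nat.cast_inj] at hcount
    exact Finset.mem_filter.2 ⟨Finset.mem_powersetCard.2
      ⟨Finset.filter_subset_filter _ hT.subset, hcount⟩, hleftT.symm ▸ hT⟩
  · have hT := (Finset.mem_filter.1 hJ).2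
    exact Finset.mem_filter.2 ⟨Finset.mem_powerset.2 hT.subset, hT⟩
  · exact facesOfDim_add_one_skeleton_union
      (Finset.mem_powersetCard.1 (Finset.mem_filter.1 hJ).1).1

theorem isSpanningTree_skeleton_union_iff (hS : IsComplex S) (hj : -1 ≤ j)
    (hp : ∀ F ∈ S, ∀ v ∈ F, p ≤ v) (hcone : IsNearCone p (facesOfDim S j))
    (hm : ((facesAvoiding p S j).card : ℤ) =
      (facesOfDim S (j + 1)).card - redBetti S (j + 1) + redBetti S j)
    (hne : (facesAvoiding p S j).Nonempty) (hJ : J ⊆ facesOfDim S (j + 1))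
    (e : facesAvoiding p S j ≃ J) :
    IsSpanningTree S (j + 1) (skeleton S j ∪ J) ↔ (incidenceMinor e).det ≠ 0 := by
  have hT := isComplex_skeleton_union hS hj hJ
  have hpT : ∀ F ∈ skeleton S j ∪ J, ∀ v ∈ F, p ≤ v := fun F hF =>
    hp F (skeleton_union_subset hJ hF)
  have hrow := facesAvoiding_skeleton_union (p := p) hJ
  have hcol := facesOfDim_add_one_skeleton_union hJ
  have hacyclic := subsingleton_redHomology_iff_det_ne_zero hT hpT
    (facesOfDim_add_two_skeleton_union hJ) hrow hcol e
  refine ⟨fun h => hacyclic.1 h.acyclic, fun h => ?_⟩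
  have hcard : J.card = (facesAvoiding p S j).card := (Finset.card_eq_of_equiv e).symm
  obtain ⟨F, hF⟩ : J.Nonempty := by rwa [← Finset.card_pos, hcard, Finset.card_pos]
  refine ⟨hT, skeleton_union_subset hJ,
    ⟨⟨F, Finset.mem_union_right _ hF, (mem_facesOfDim.1 (hJ hF)).2⟩,
      card_le_of_mem_skeleton_union hJ⟩, ?_, hacyclic.2 h, ?_, ?_⟩
  · rw [add_sub_cancel_right, skeleton_skeleton_union hJ]
  · rw [add_sub_cancel_right]
    apply Nat.finite_of_card_ne_zero
    rw [natCard_redHomology_eq_natAbs_det hT hpT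
      ((facesOfDim_skeleton_union hJ).symm ▸ hcone) hrow hcol e h]
    exact Int.natAbs_ne_zero.2 h
  · rw [hcol, hcard, add_sub_cancel_right, hm]

theorem intCast_weightedIncidence (G F : Finset ℕ) :
    ((weightedIncidence (1 : ℕ → ℤ) G F : ℤ) : R) = weightedIncidence (1 : ℕ → R) G F := by
  simp only [weightedIncidence, Int.cast_sum, Int.cast_ite, Int.cast_mul, Int.cast_zero,
    Pi.one_apply, Int.cast_one, Int.cast_id]

theorem det_submatrix_weightedIncidence (e : N ≃ J) :
    ((Matrix.of fun (G : N) F => weightedIncidence (1 : ℕ → R) G.1 F).submatrix id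
      fun i => (e i : Finset ℕ)).det = ((incidenceMinor e).det : R) := by
  rw [Int.cast_det]
  congr 1
  ext G G'
  exact (intCast_weightedIncidence G.1 (e G').1).symm

theorem det_submatrix_mul_weightedIncidence (w : Finset ℕ → R) (e : N ≃ J) :
    ((Matrix.of fun F (G : N) => w F * weightedIncidence (1 : ℕ → R) G.1 F).submatrix
      (fun i => (e i : Finset ℕ)) id).det = (∏ F ∈ J, w F) * ((incidenceMinor e).det : R) := by
  rw [← det_submatrix_weightedIncidence, ← Finset.prod_coe_sort J, ← e.prod_comp,
    ← Matrix.det_transpose (Matrix.submatrix _ id _), ← Matrix.det_mul_column]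
  rfl

theorem facesAvoiding_nonempty (hS : IsComplex S) (hdim : HasDim S (j + 1)) (hj : -1 ≤ j) :
    (facesAvoiding p S j).Nonempty := by
  obtain ⟨F, hFS, hcard⟩ := hdim.1
  have hF : F ∈ facesOfDim S (j + 1) := mem_facesOfDim.2 ⟨hFS, hcard⟩
  obtain ⟨v, hv, hpv⟩ : ∃ v ∈ F, p ∉ F.erase v := by
    by_cases hpF : p ∈ F
    · exact ⟨p, hpF, Finset.notMem_erase p F⟩
    · obtain ⟨v, hv⟩ : F.Nonempty := by
        rw [← Finset.card_pos]
        lia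
      exact ⟨v, hv, fun h => hpF (Finset.mem_of_mem_erase h)⟩
  exact ⟨F.erase v,
    Finset.mem_nonMemberSubfamily.2 ⟨hS.erase_mem_facesOfDim rfl hF hv, hpv⟩⟩

theorem treeEnumerator_eq_det_reducedLaplacian (w : Finset ℕ → R) (hS : IsComplex S)
    (hdim : HasDim S (j + 1)) (hj : -1 ≤ j) (hp : ∀ F ∈ S, ∀ v ∈ F, p ≤ v)
    (hcone : IsNearCone p S) (hβ : redBetti S j = 0) :
    treeEnumerator S (j + 1) w = (reducedLaplacian (fun F => w F ^ 2) p S j).det := by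
  classical
  have hconej := hcone.isNearCone_facesOfDim j
  have hm : ((facesAvoiding p S j).card : ℤ) =
      (facesOfDim S (j + 1)).card - redBetti S (j + 1) + redBetti S j := by
    rw [← redBetti_add_card_facesAvoiding hS hp hdim.facesOfDim_add_one_eq_empty
      fun G => insert_mem_facesOfDim fun G => hcone.insert_mem_of_redBetti_eq_zero hS hp hβ, hβ]
    lia
  have hne := facesAvoiding_nonempty (p := p) hS hdim hj
  rw [treeEnumerator_eq_sum_powersetCard w hm, ← Fintype.card_coe]
  refine (det_sum_mul_eq_sum_powersetCard (facesOfDim S (j + 1))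
    (Matrix.of fun (G : facesAvoiding p S j) F => weightedIncidence (1 : ℕ → R) G.1 F)
    (Matrix.of fun F (G : facesAvoiding p S j) =>
      w F ^ 2 * weightedIncidence (1 : ℕ → R) G.1 F) _ fun J hJ => ?_).symm
  rw [Finset.mem_powersetCard, Fintype.card_coe] at hJ
  let e := Finset.equivOfCardEq hJ.2.symm
  refine ⟨e, ?_⟩
  have htree := isSpanningTree_skeleton_union_iff hS hj hp hconej hm hne hJ.1 e
  rw [det_submatrix_weightedIncidence, det_submatrix_mul_weightedIncidence (fun F => w F ^ 2)]
  split_ifs with h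
  · rw [natCard_redHomology_eq_natAbs_det (isComplex_skeleton_union hS hj hJ.1)
      (fun F hF => hp F (skeleton_union_subset hJ.1 hF))
      ((facesOfDim_skeleton_union hJ.1).symm ▸ hconej) (facesAvoiding_skeleton_union hJ.1)
      (facesOfDim_add_one_skeleton_union hJ.1) e (htree.1 h), ← Int.cast_natCast,
      ← Int.cast_pow, Int.natAbs_sq, Int.cast_pow]
    ring
  · rw [not_not.1 (mt htree.2 h), Int.cast_zero, zero_mul]

end MatrixTree

/-! ### Shifted complexes -/

section Shifted

variable {n : ℕ} {j : ℤ} {S : Finset (Finset ℕ)}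

theorem IsShiftedOn.le_of_hasDim {p : ℕ} (hshifted : IsShiftedOn p n S) (hdim : HasDim S (j + 1))
    (hj : -1 ≤ j) : p ≤ n := by
  obtain ⟨F, hF, hcard⟩ := hdim.1
  obtain ⟨v, hv⟩ : F.Nonempty := by
    rw [← Finset.card_pos]
    lia
  have hpvn := Finset.mem_Icc.1 (hshifted.1 F hF hv)
  exact hpvn.1.trans hpvn.2

theorem IsShiftedOn.isShiftedOn_facesOfDim {p : ℕ} (hshifted : IsShiftedOn p n S) (i : ℤ) :
    IsShiftedOn p n (facesOfDim S i) := by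
  refine ⟨fun F hF => hshifted.1 F (mem_facesOfDim.1 hF).1, fun F hF u hu v hv huv huF hvF => ?_⟩
  rw [mem_facesOfDim] at hF ⊢
  rw [Finset.card_insert_of_notMem fun h => huF (Finset.mem_of_mem_erase h),
    Finset.card_erase_add_one hvF]
  exact ⟨hshifted.2 F hF.1 u hu v hv huv huF hvF, hF.2⟩

theorem IsShiftedOn.det_one_add_smul_gramMatrix_facesAvoiding {K : Type*} [Field K] (x : ℕ → K)
    (hx : ∀ t, 1 ≤ t → ∑ i ∈ Finset.Icc 1 t, x i ^ 2 ≠ 0) (hS : IsComplex S)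
    (hshifted : IsShiftedOn 1 n S) :
    (1 + (x 1 ^ 2)⁻¹ • gramMatrix x (facesAvoiding 1 S j) (facesAvoiding 1 S (j + 1))).det =
      ∏ v ∈ Finset.Icc 2 n,
        ((∑ i ∈ Finset.Icc 1 v, x i ^ 2) / ∑ i ∈ Finset.Icc 1 (v - 1), x i ^ 2) ^
          familyDegree (facesAvoiding 1 S (j + 1)) v := by
  have hfaces : ∀ F ∈ facesAvoiding 1 S (j + 1), ∀ v ∈ F, F.erase v ∈ facesAvoiding 1 S j := by
    intro F hF v hv
    rw [Finset.mem_nonMemberSubfamily] at hF ⊢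
    exact ⟨hS.erase_mem_facesOfDim rfl hF.1 hv, fun h => hF.2 (Finset.mem_of_mem_erase h)⟩
  have hgram := IsShiftedOn.det_one_add_smul_gramMatrix x
    (g := fun v => ∑ i ∈ Finset.Icc 1 (v - 1), x i ^ 2)
    (hshifted.isShiftedOn_facesOfDim (j + 1)).nonMemberSubfamily hfaces (fun v hv => hx _ (by lia))
    fun v hv => by
      obtain ⟨t, rfl⟩ := Nat.exists_eq_add_of_le' (one_le_two.trans hv)
      exact Finset.sum_Icc_succ_top t.succ_pos _
  simpa only [Nat.reduceAdd, Nat.reduceSub, Finset.Icc_self, Finset.sum_singleton,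
    Nat.add_sub_cancel] using hgram

theorem IsShiftedOn.treeEnumerator_of_sum_sq_ne_zero {K : Type*} [Field K] (x : ℕ → K)
    (hx : ∀ t, 1 ≤ t → ∑ i ∈ Finset.Icc 1 t, x i ^ 2 ≠ 0) (hS : IsComplex S)
    (hdim : HasDim S (j + 1)) (hj : -1 ≤ j) (hshifted : IsShiftedOn 1 n S)
    (hβ : redBetti S j = 0) :
    treeEnumerator S (j + 1) (fun F => ∏ v ∈ F, x v) =
      (∏ v ∈ Finset.Icc 1 n,
        (x v ^ 2) ^ familyDegree (facesOfDim (cone 1 (link 1 S)) (j + 1)) v) *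
      ∏ i ∈ Finset.Icc 1
          (conjLength n (familyDegree (facesOfDim (cone 1 (deletion 1 S)) (j + 1 + 1)))),
        ((∑ t ∈ Finset.Icc 1 (conjPart n
          (familyDegree (facesOfDim (cone 1 (deletion 1 S)) (j + 1 + 1))) i), x t ^ 2) /
          x 1 ^ 2) := by
  have hp : ∀ F ∈ S, ∀ v ∈ F, 1 ≤ v := fun F hF v hv => (Finset.mem_Icc.1 (hshifted.1 F hF hv)).1
  have htop := hdim.facesOfDim_add_one_eq_empty
  have hins : ∀ G ∈ facesAvoiding 1 S j, insert 1 G ∈ S := fun G =>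
    hshifted.isNearCone.insert_mem_of_redBetti_eq_zero hS hp hβ
  have hE : ∑ t ∈ Finset.Icc 1 1, x t ^ 2 = x 1 ^ 2 := by
    rw [Finset.Icc_self, Finset.sum_singleton]
  have hx1 : x 1 ≠ 0 := pow_ne_zero_iff two_ne_zero |>.1 (hE ▸ hx 1 le_rfl)
  have hcone : ∀ F ∈ (facesAvoiding 1 S j).image (insert 1), F ⊆ Finset.Icc 1 n :=
    Finset.forall_mem_image.2 fun G hG => hshifted.1 _ (hins G hG)
  have hanti := ((hshifted.isShiftedOn_facesOfDim (j + 1)).nonMemberSubfamily.image_insert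
    (hshifted.le_of_hasDim hdim hj)).antitoneOn_familyDegree
  rw [treeEnumerator_eq_det_reducedLaplacian _ hS hdim hj hp hshifted.isNearCone hβ,
    det_reducedLaplacian x hx1 hS hp hins, facesOfDim_cone_link hS htop hins,
    facesOfDim_cone_deletion hS htop, prod_pow_familyDegree hcone, ← hE,
    prod_conjPart_div (E := fun t => ∑ i ∈ Finset.Icc 1 t, x i ^ 2) hx hanti, hE,
    hshifted.det_one_add_smul_gramMatrix_facesAvoiding x hx hS]
  congr 1
  refine Finset.prod_congr rfl fun v hv => ?_
  rw [familyDegree_image_insert (fun F hF => (Finset.mem_nonMemberSubfamily.1 hF).2)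
    (Nat.lt_of_succ_le (Finset.mem_Icc.1 hv).1).ne']

theorem map_treeEnumerator {R R' : Type*} [CommRing R] [CommRing R'] (f : R →+* R') (k : ℤ)
    (w : Finset ℕ → R) : f (treeEnumerator S k w) = treeEnumerator S k fun F => f (w F) := by
  simp only [treeEnumerator, map_sum, map_mul, map_pow, map_natCast, map_prod]

theorem sum_Icc_X_sq_ne_zero {t : ℕ} (ht : 1 ≤ t) :
    ∑ i ∈ Finset.Icc 1 t, (MvPolynomial.X i : MvPolynomial ℕ ℤ) ^ 2 ≠ 0 := fun h => by
  have heval := congrArg (MvPolynomial.eval fun _ => (1 : ℤ)) h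
  simp only [map_sum, map_pow, MvPolynomial.eval_X, one_pow, Finset.sum_const, Nat.card_Icc,
    nsmul_eq_mul, mul_one, map_zero, Nat.cast_eq_zero, Nat.add_sub_cancel] at heval
  lia

/-- The identity is one of integer polynomials, so it suffices to check it for indeterminates, whose
partial sums of squares are invertible. -/
theorem IsShiftedOn.treeEnumerator_mul_pow_conjLength {R : Type*} [CommRing R] (x : ℕ → R)
    (hS : IsComplex S) (hdim : HasDim S (j + 1)) (hj : -1 ≤ j) (hshifted : IsShiftedOn 1 n S)
    (hβ : redBetti S j = 0) :
    treeEnumerator S (j + 1) (fun F => ∏ v ∈ F, x v) *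
      (x 1 ^ 2) ^ conjLength n
        (familyDegree (facesOfDim (cone 1 (deletion 1 S)) (j + 1 + 1))) =
      (∏ v ∈ Finset.Icc 1 n,
        (x v ^ 2) ^ familyDegree (facesOfDim (cone 1 (link 1 S)) (j + 1)) v) *
      ∏ i ∈ Finset.Icc 1
          (conjLength n (familyDegree (facesOfDim (cone 1 (deletion 1 S)) (j + 1 + 1)))),
        ∑ t ∈ Finset.Icc 1 (conjPart n
          (familyDegree (facesOfDim (cone 1 (deletion 1 S)) (j + 1 + 1))) i), x t ^ 2 := by
  let ι := algebraMap (MvPolynomial ℕ ℤ) (FractionRing (MvPolynomial ℕ ℤ))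
  have hι : Function.Injective ι := IsFractionRing.injective _ _
  have hsum : ∀ t, 1 ≤ t → ∑ i ∈ Finset.Icc 1 t, ι (MvPolynomial.X i) ^ 2 ≠ 0 := fun t ht => by
    simpa only [map_sum, map_pow] using
      (map_ne_zero_iff ι hι).2 (sum_Icc_X_sq_ne_zero ht)
  have hX : ι (MvPolynomial.X 1) ^ 2 ≠ 0 :=
    pow_ne_zero 2 ((map_ne_zero_iff ι hι).2 (MvPolynomial.X_ne_zero 1))
  have hgeneric := hshifted.treeEnumerator_of_sum_sq_ne_zero _ hsum hS hdim hj hβ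
  rw [Finset.prod_div_distrib, Finset.prod_const, Nat.card_Icc, Nat.add_sub_cancel,
    ← mul_div_assoc, eq_div_iff (pow_ne_zero _ hX)] at hgeneric
  simp only [← map_pow, ← map_sum, ← map_prod, ← map_mul, ← map_treeEnumerator] at hgeneric
  simpa only [map_mul, map_pow, map_prod, map_sum, map_treeEnumerator,
    MvPolynomial.coe_eval₂Hom, MvPolynomial.eval₂_X] using
    congrArg (MvPolynomial.eval₂Hom (Int.castRingHom R) x) (hι hgeneric)

end Shifted

theorem corollary8p2_general {K : Type*} [Field K] (x : ℕ → K) (hx : x 1 ≠ 0) (n d : ℕ)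
    (S : Finset (Finset ℕ)) (hS : IsComplex S) (hdim : HasDim S d) (hshifted : IsShiftedOn 1 n S)
    (hβ : redBetti S (d - 1) = 0) :
    treeEnumerator S d (fun F => ∏ v ∈ F, x v) =
      (∏ v ∈ Finset.Icc 1 n,
        (x v ^ 2) ^ familyDegree (facesOfDim (cone 1 (link 1 S)) d) v) *
      ∏ i ∈ Finset.Icc 1
          (conjLength n (familyDegree (facesOfDim (cone 1 (deletion 1 S)) (d + 1)))),
        ((∑ t ∈ Finset.Icc 1 (conjPart n
          (familyDegree (facesOfDim (cone 1 (deletion 1 S)) (d + 1))) i), x t ^ 2) /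
          x 1 ^ 2) := by
  have hd : (d : ℤ) - 1 + 1 = d := sub_add_cancel _ _
  have hcleared := hshifted.treeEnumerator_mul_pow_conjLength (j := d - 1) x hS
    (hd.symm ▸ hdim) (by lia) hβ
  rw [hd] at hcleared
  rw [Finset.prod_div_distrib, Finset.prod_const, Nat.card_Icc, Nat.add_sub_cancel,
    ← mul_div_assoc, eq_div_iff (pow_ne_zero _ (pow_ne_zero 2 hx)), hcleared]

theorem corollary8p2 (𝕜 : Type*) [Field 𝕜] [CharZero 𝕜] (n d : ℕ) (S : Finset (Finset ℕ))
    (hcomplex : IsComplex S) (hdim : HasDim S d) (hshifted : IsShiftedOn 1 n S)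
    (hAPC : IsAPC S d) :
    treeEnumerator S d (coarseWeight 𝕜) =
      (∏ v ∈ Finset.Icc 1 n,
        XVar 𝕜 v ^ familyDegree (facesOfDim (cone 1 (link 1 S)) d) v) *
      ∏ i ∈ Finset.Icc 1
          (conjLength n (familyDegree (facesOfDim (cone 1 (deletion 1 S)) (d + 1)))),
        (EForm 𝕜 (conjPart n (familyDegree (facesOfDim (cone 1 (deletion 1 S)) (d + 1))) i) /
          XVar 𝕜 1) :=
  corollary8p2_general (xVar 𝕜) ((map_ne_zero_iff _ (IsFractionRing.injective _ _)).2
    (MvPolynomial.X_ne_zero 1)) n d S hcomplex hdim hshifted (hAPC _ (sub_one_lt _))
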